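/- Let $P$ be a finite set of points in the Euclidean plane whose pairwise distances are all distinct, i.e. $\|p-q\|=\|r-s\|$ with $p\ne q$, $r\ne s$ in $P$ implies $\{p,q\}=\{r,s\}$. A triangulation of $P$ is a geometric simplicial complex whose vertex set is exactly $P$ and whose underlying space is the convex hull of $P$. For a triangulation $\tau$ of $P$, let $A(\tau)$ be the list of all the angles of all triangles of $\tau$ (with multiplicity), sorted from smallest to largest. A max-min angle Delaunay triangulation of $P$ is a triangulation $\tau$ of $P$ such that $A(\tau)\ge A(\sigma)$ in the lexicographical order for every triangulation $\sigma$ of $P$. Then $P$ has exactly one max-min angle Delaunay triangulation. -/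

import Mathlib

noncomputable section

namespace MaxMinAngle

/-- The Euclidean plane. -/
abbrev Plane : Type := EuclideanSpace ℝ (Fin 2)

/-- All pairwise distances in `P` are distinct: two unordered pairs of different points of `P`
at the same distance are the same pair. -/
def DistinctPairwiseDistances (P : Finset Plane) : Prop :=
  ∀ p ∈ P, ∀ q ∈ P, ∀ r ∈ P, ∀ s ∈ P,
    p ≠ q → r ≠ s → dist p q = dist r s → s(p, q) = s(r, s)

/-- `τ` is a triangulation of the finite point set `P`: a (geometric) simplicial complex whose
vertices are exactly the points of `P` and whose underlying space is the convex hull of `P`. -/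
structure IsTriangulation (P : Finset Plane) (τ : Geometry.SimplicialComplex ℝ Plane) : Prop where
  vertices_eq : τ.vertices = (P : Set Plane)
  space_eq : τ.space = convexHull ℝ (P : Set Plane)

/-- The angle at `v` subtended by the unordered pair `s(a, b)`, that is `∠ a v b`. -/
def cornerAngle (v : Plane) : Sym2 Plane → ℝ :=
  Sym2.lift ⟨fun a b => EuclideanGeometry.angle a v b,
    fun a b => EuclideanGeometry.angle_comm a v b⟩

open scoped Classical in
/-- The three angles of a triangle `t` given by its set of vertices: each vertex `v` of `t`
contributes the angle subtended at `v` by the pair of the two other vertices. -/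
def triangleAngles (t : Finset Plane) : Multiset ℝ :=
  t.val.bind fun v => (((t.erase v).sym2.filter fun e => ¬ e.IsDiag).val.map (cornerAngle v))

open scoped Classical in
/-- The triangles (two-dimensional faces) of `τ` with vertices in `P`. -/
def triangles (P : Finset Plane) (τ : Geometry.SimplicialComplex ℝ Plane) :
    Finset (Finset Plane) :=
  (P.powersetCard 3).filter fun t => t ∈ τ.faces

/-- The list `A(τ)` of all the angles of all the triangles of `τ`, with multiplicity, sorted from
smallest to largest. -/
def angleList (P : Finset Plane) (τ : Geometry.SimplicialComplex ℝ Plane) : List ℝ :=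
  ((triangles P τ).val.bind triangleAngles).sort (· ≤ ·)

/-- `τ` is a max-min angle Delaunay triangulation of `P`: among all triangulations of `P`, its
sorted list of angles is maximal for the lexicographical order (which is the order `≤` on lists
of reals). -/
def IsMaxMinAngleDelaunay (P : Finset Plane) (τ : Geometry.SimplicialComplex ℝ Plane) : Prop :=
  IsTriangulation P τ ∧ ∀ σ : Geometry.SimplicialComplex ℝ Plane,
    IsTriangulation P σ → angleList P σ ≤ angleList P τ

end MaxMinAngle

end

/-!
The proof splits according to the affine span of the point set `P`.

If `P` is collinear, it has only one triangulation, the path through its points (`pathComplex`,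
`IsTriangulation.eq_pathComplex`).

Otherwise a triangulation is determined by its set of triangles, and these sets are characterized
(`IsTiling`) by the condition that each point of the convex hull on no line through two points of
`P` (`Generic`) lies in exactly one triangle, the triangles having vertices in `P` and containing no
other points of `P`.
In this form a triangulation is easily modified: any subset of its triangles may be replaced by
triangles covering the same generic points (`IsTiling.replace`). That the triangles of a tiling meet
in common faces follows by separating their interiors by a line (`IsTiling.glue`). A tiling exists,
namely the projection of the lower hull of a small generic perturbation of the paraboloid
`p ↦ ‖p‖ ^ 2` (`exists_isTiling`), so that, by finiteness, there is one with the largest list of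
angles (`exists_isMaxTiling`).

Let `T` be such a tiling, and for a triangle `t` let `lift sq t` be the affine function that agrees
with `‖·‖ ^ 2` at the vertices of `t`; a point `q` lies inside the circumcircle of `t` if and only
if `‖q‖ ^ 2 < lift sq t q`. If the apex of one of two adjacent triangles were inside the
circumcircle of the other, flipping their common edge would be possible and would replace six angles
by six others, each of which exceeds one of the old ones (`IsTiling.exists_flip`); so the smallest
angle involved would increase, and with it the list of angles. Hence `T` is locally Delaunay, and
therefore no circumcircle has any point of `P` inside (`IsTiling.lift_le_of_local`).

Let `S` be a second optimal tiling. Triangles of `T` and `S` over a common generic point have the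
same circumcircle (`lift_eq_of_generic`), so for each circle the triangles `X` of `T` and `Y` of `S`
inscribed in it cover the same region and may be exchanged. If neither of the angle multisets of `X`
and `Y` contained the other, one of the two exchanges would improve `T` or `S`, since the
lexicographic comparison is not affected by the remaining angles (`sort_add_lt_or`). So, say, all
angles of `X` occur in `Y`. By the law of sines an angle determines the length of the opposite
chord, and by the hypothesis on `P` this length determines the edge; thus all edges of `X` are edges
of `Y`, which forces `X ⊆ Y` (`trianglesOver_subset`, `IsTiling.mem_of_edges`) and then `X = Y`.
-/

noncomputable section

namespace MaxMinAngle

variable {P t : Finset Plane} {S T : Finset (Finset Plane)}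

/-! ### Barycentric coordinates of a triangle -/

/-- `t` is the vertex set of a nondegenerate triangle. -/
def IsTriangle (t : Finset Plane) : Prop :=
  t.card = 3 ∧ AffineIndependent ℝ ((↑) : t → Plane)

/-- The affine basis of the plane formed by the vertices of a triangle. -/
def IsTriangle.basis {t : Finset Plane} (h : IsTriangle t) : AffineBasis t ℝ Plane :=
  ⟨(↑), h.2, by
    rw [h.2.affineSpan_eq_top_iff_card_eq_finrank_add_one]
    simp [h.1]⟩

lemma IsTriangle.coe_basis {t : Finset Plane} (h : IsTriangle t) :
    ⇑h.basis = ((↑) : t → Plane) := rfl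

open scoped Classical in
/-- The barycentric coordinate with respect to the vertex `v` of the triangle `t`; it is `0` by
convention if `t` is not a triangle or `v` is not one of its vertices. -/
def bary (t : Finset Plane) (v : Plane) : Plane →ᵃ[ℝ] ℝ :=
  if h : IsTriangle t ∧ v ∈ t then h.1.basis.coord ⟨v, h.2⟩ else 0


lemma IsTriangle.bary_eq (h : IsTriangle t) (v : t) : bary t v = h.basis.coord v := by
  simp [bary, h]

lemma IsTriangle.bary_self (h : IsTriangle t) {v : Plane} (hv : v ∈ t) : bary t v v = 1 := by
  have := h.basis.coord_apply_eq ⟨v, hv⟩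
  rw [← h.bary_eq] at this
  exact this

lemma IsTriangle.bary_of_ne (h : IsTriangle t) {v w : Plane} (hv : v ∈ t) (hw : w ∈ t)
    (hvw : v ≠ w) : bary t v w = 0 := by
  have := h.basis.coord_apply_ne (i := ⟨v, hv⟩) (j := ⟨w, hw⟩) (by simpa using hvw)
  rw [← h.bary_eq] at this
  exact this

lemma IsTriangle.sum_bary (h : IsTriangle t) (x : Plane) : ∑ v ∈ t, bary t v x = 1 := by
  rw [← h.basis.sum_coord_apply_eq_one x, ← Finset.sum_coe_sort]
  simp [h.bary_eq]

lemma IsTriangle.sum_bary_smul (h : IsTriangle t) (x : Plane) :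
    ∑ v ∈ t, bary t v x • v = x := by
  conv_rhs => rw [← h.basis.linear_combination_coord_eq_self x]
  rw [← Finset.sum_coe_sort]
  simp [h.bary_eq, h.coe_basis]

lemma affineMap_apply_sum (f : Plane →ᵃ[ℝ] ℝ) (s : Finset Plane) (w : Plane → ℝ)
    (hw : ∑ v ∈ s, w v = 1) : f (∑ v ∈ s, w v • v) = ∑ v ∈ s, w v * f v := by
  have hf : ∀ y, f y = f.linear y + f 0 := fun y => by
    have := congrFun f.decomp y
    simpa using this
  rw [hf, map_sum]
  conv_rhs => enter [2, v]; rw [hf v]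
  simp only [map_smul, smul_eq_mul, mul_add, Finset.sum_add_distrib, ← Finset.sum_mul, hw, one_mul]

/-- An affine function is determined by its values at the vertices of a triangle. -/
lemma IsTriangle.affineMap_apply (h : IsTriangle t) (f : Plane →ᵃ[ℝ] ℝ) (x : Plane) :
    f x = ∑ v ∈ t, bary t v x * f v := by
  rw [← affineMap_apply_sum f t _ (h.sum_bary x), h.sum_bary_smul]

lemma IsTriangle.affineMap_ext (h : IsTriangle t) {f g : Plane →ᵃ[ℝ] ℝ}
    (hfg : ∀ v ∈ t, f v = g v) : f = g := by
  ext x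
  rw [h.affineMap_apply f, h.affineMap_apply g]
  exact Finset.sum_congr rfl fun v hv => by rw [hfg v hv]

lemma affineMap_nonneg_of_mem_convexHull (f : Plane →ᵃ[ℝ] ℝ) {s : Set Plane}
    (hs : ∀ v ∈ s, 0 ≤ f v) {x : Plane} (hx : x ∈ convexHull ℝ s) : 0 ≤ f x :=
  convexHull_min (t := f ⁻¹' Set.Ici 0) hs ((convex_Ici 0).affine_preimage f) hx

lemma affineMap_eq_zero_of_mem_convexHull (f : Plane →ᵃ[ℝ] ℝ) {s : Set Plane}
    (hs : ∀ v ∈ s, f v = 0) {x : Plane} (hx : x ∈ convexHull ℝ s) : f x = 0 :=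
  convexHull_min (t := f ⁻¹' {0}) hs ((convex_singleton 0).affine_preimage f) hx

lemma IsTriangle.bary_nonneg (h : IsTriangle t) {v x : Plane}
    (hx : x ∈ convexHull ℝ (t : Set Plane)) (hv : v ∈ t) : 0 ≤ bary t v x := by
  refine affineMap_nonneg_of_mem_convexHull _ (fun w hw => ?_) hx
  by_cases hvw : v = w
  · subst hvw; rw [h.bary_self hv]; exact zero_le_one
  · rw [h.bary_of_ne hv hw hvw]

lemma IsTriangle.bary_eq_zero (h : IsTriangle t) {u : Finset Plane} (hu : u ⊆ t) {v x : Plane}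
    (hx : x ∈ convexHull ℝ (u : Set Plane)) (hv : v ∈ t) (hvu : v ∉ u) : bary t v x = 0 :=
  affineMap_eq_zero_of_mem_convexHull _ (fun _ hw => h.bary_of_ne hv (hu hw)
    (fun e => hvu (e ▸ hw))) hx

lemma IsTriangle.mem_convexHull_sub (h : IsTriangle t) {u : Finset Plane} (hu : u ⊆ t) {x : Plane}
    (hx : ∀ v ∈ t, 0 ≤ bary t v x) (hx0 : ∀ v ∈ t, v ∉ u → bary t v x = 0) :
    x ∈ convexHull ℝ (u : Set Plane) := by
  have h1 : ∑ v ∈ u, bary t v x = 1 := by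
    rw [← h.sum_bary x]
    exact Finset.sum_subset hu hx0
  have h2 : ∑ v ∈ u, bary t v x • v = x := by
    conv_rhs => rw [← h.sum_bary_smul x]
    exact Finset.sum_subset hu fun v hv hvu => by rw [hx0 v hv hvu, zero_smul]
  rw [← h2]
  exact (convex_convexHull ℝ _).sum_mem (fun v hv => hx v (hu hv)) h1
    (fun v hv => subset_convexHull ℝ _ hv)

lemma IsTriangle.mem_convexHull_iff (h : IsTriangle t) {x : Plane} :
    x ∈ convexHull ℝ (t : Set Plane) ↔ ∀ v ∈ t, 0 ≤ bary t v x :=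
  ⟨fun hx _ hv => h.bary_nonneg hx hv,
    fun hx => h.mem_convexHull_sub subset_rfl hx fun _ hv hv' => absurd hv hv'⟩

lemma IsTriangle.interior_eq (h : IsTriangle t) :
    interior (convexHull ℝ (t : Set Plane)) = {x | ∀ v ∈ t, 0 < bary t v x} := by
  have := h.basis.interior_convexHull
  have hr : Set.range h.basis = (t : Set Plane) := by
    simp [h.coe_basis]
  rw [hr] at this
  rw [this]
  ext x
  simp only [Set.mem_ofPred_eq, Subtype.forall]
  exact forall₂_congr fun v hv => by rw [← h.bary_eq]

lemma IsTriangle.nonempty_interior (h : IsTriangle t) :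
    (interior (convexHull ℝ (t : Set Plane))).Nonempty := by
  rw [interior_convexHull_nonempty_iff_affineSpan_eq_top]
  simpa [h.coe_basis] using h.basis.tot

lemma IsTriangle.isClosed (t : Finset Plane) : IsClosed (convexHull ℝ (t : Set Plane)) :=
  t.finite_toSet.isClosed_convexHull ℝ

/-- The affine function interpolating `ψ` at the vertices of the triangle `t`. -/
def lift (ψ : Plane → ℝ) (t : Finset Plane) : Plane →ᵃ[ℝ] ℝ := ∑ v ∈ t, ψ v • bary t v

lemma lift_apply (ψ : Plane → ℝ) (t : Finset Plane) (x : Plane) :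
    lift ψ t x = ∑ v ∈ t, bary t v x * ψ v := by
  have : ∀ s : Finset Plane, (∑ v ∈ s, ψ v • bary t v) x = ∑ v ∈ s, bary t v x * ψ v := by
    intro s
    classical
    induction s using Finset.induction_on with
    | empty => simp
    | insert a s ha ih => rw [Finset.sum_insert ha, Finset.sum_insert ha, AffineMap.coe_add,
        Pi.add_apply, ih]; simp [mul_comm]
  exact this t

lemma IsTriangle.lift_vertex (h : IsTriangle t) (ψ : Plane → ℝ) {v : Plane} (hv : v ∈ t) :
    lift ψ t v = ψ v := by
  rw [lift_apply, Finset.sum_eq_single_of_mem v hv fun w hw hwv => by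
    rw [h.bary_of_ne hw hv hwv, zero_mul], h.bary_self hv, one_mul]

/-! ### Faces on a common line -/

lemma exists_eq_pair_of_card_le_two {e : Finset Plane} (hne : e.Nonempty) (he : e.card ≤ 2) :
    ∃ a b, (e : Set Plane) = {a, b} := by
  classical
  have h1 := hne.card_pos
  obtain h | h : e.card = 1 ∨ e.card = 2 := by omega
  · obtain ⟨a, rfl⟩ := Finset.card_eq_one.1 h
    exact ⟨a, a, by simp⟩
  · obtain ⟨a, b, -, rfl⟩ := Finset.card_eq_two.1 h
    exact ⟨a, b, by simp⟩

lemma mem_convexHull_pair_lineMap {φ : ℝ →ᵃ[ℝ] Plane} {α β : ℝ} (h : α ≤ β) {x : Plane} :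
    x ∈ convexHull ℝ ({φ α, φ β} : Set Plane) ↔ ∃ ξ, α ≤ ξ ∧ ξ ≤ β ∧ φ ξ = x := by
  rw [convexHull_pair, ← image_segment, segment_eq_Icc h]
  simp [and_assoc]

lemma glue_of_ordered {φ : ℝ →ᵃ[ℝ] Plane} (hφ : Function.Injective φ) {e f : Set Plane}
    {α β γ δ : ℝ} (he : e = {φ α, φ β}) (hf : f = {φ γ, φ δ}) (hαβ : α ≤ β) (hγδ : γ ≤ δ)
    (hαγ : α ≤ γ) (hef : ∀ p ∈ f, p ∈ convexHull ℝ e → p ∈ e)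
    (hfe : ∀ p ∈ e, p ∈ convexHull ℝ f → p ∈ f) {x : Plane}
    (hxe : x ∈ convexHull ℝ e) (hxf : x ∈ convexHull ℝ f) : x ∈ convexHull ℝ (e ∩ f) := by
  have me : ∀ {y}, y ∈ convexHull ℝ e ↔ ∃ ξ, α ≤ ξ ∧ ξ ≤ β ∧ φ ξ = y := fun {y} => by
    rw [he]; exact mem_convexHull_pair_lineMap hαβ
  have mf : ∀ {y}, y ∈ convexHull ℝ f ↔ ∃ ξ, γ ≤ ξ ∧ ξ ≤ δ ∧ φ ξ = y := fun {y} => by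
    rw [hf]; exact mem_convexHull_pair_lineMap hγδ
  obtain ⟨ξ, h1, h2, rfl⟩ := me.1 hxe
  obtain ⟨ξ', h3, h4, h5⟩ := mf.1 hxf
  obtain rfl := hφ h5
  have hc : φ γ ∈ e := hef _ (by simp [hf]) (me.2 ⟨γ, hαγ, h3.trans h2, rfl⟩)
  have hc' : φ γ = φ α ∨ φ γ = φ β := by simpa [he] using hc
  rcases hc' with h | h
  · obtain rfl := hφ h
    rcases le_total β δ with h6 | h6
    · have hb : φ β ∈ f := hfe _ (by simp [he]) (mf.2 ⟨β, hαβ, h6, rfl⟩)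
      refine convexHull_mono ?_ hxe
      rintro p hp
      refine ⟨hp, ?_⟩
      rcases (by simpa [he] using hp : p = φ γ ∨ p = φ β) with rfl | rfl
      · simp [hf]
      · exact hb
    · have hb : φ δ ∈ e := hef _ (by simp [hf]) (me.2 ⟨δ, hγδ, h6, rfl⟩)
      refine convexHull_mono ?_ hxf
      rintro p hp
      refine ⟨?_, hp⟩
      rcases (by simpa [hf] using hp : p = φ γ ∨ p = φ δ) with rfl | rfl
      · exact hc
      · exact hb
  · obtain rfl := hφ h
    obtain rfl : γ = ξ' := le_antisymm h3 h2
    exact subset_convexHull ℝ _ ⟨hc, by simp [hf]⟩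

/-- Two segments (or points) on a common line, neither of which contains an endpoint of the other
except as its own endpoint, meet in the hull of their common endpoints. -/
lemma glue_of_collinear {e f : Finset Plane} (hc : Collinear ℝ ((e : Set Plane) ∪ f))
    (he2 : e.card ≤ 2) (hf2 : f.card ≤ 2)
    (hef : ∀ p ∈ f, p ∈ convexHull ℝ (e : Set Plane) → p ∈ e)
    (hfe : ∀ p ∈ e, p ∈ convexHull ℝ (f : Set Plane) → p ∈ f) {x : Plane}
    (hxe : x ∈ convexHull ℝ (e : Set Plane)) (hxf : x ∈ convexHull ℝ (f : Set Plane)) :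
    x ∈ convexHull ℝ ((e : Set Plane) ∩ f) := by
  obtain ⟨a, b, he⟩ := exists_eq_pair_of_card_le_two
    (Finset.coe_nonempty.1 (convexHull_nonempty_iff.1 ⟨x, hxe⟩)) he2
  obtain ⟨c, d, hf⟩ := exists_eq_pair_of_card_le_two
    (Finset.coe_nonempty.1 (convexHull_nonempty_iff.1 ⟨x, hxf⟩)) hf2
  obtain ⟨p₀, v, hv⟩ := (collinear_iff_exists_forall_eq_smul_vadd _).1 hc
  obtain ⟨φ, hφ⟩ : ∃ φ : ℝ →ᵃ[ℝ] Plane, ∀ r, φ r = r • v +ᵥ p₀ :=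
    ⟨AffineMap.lineMap p₀ (v +ᵥ p₀), fun r => by simp [AffineMap.lineMap_apply]⟩
  simp_rw [← hφ] at hv
  by_cases h0 : v = 0
  · have hp : ∀ p ∈ (e : Set Plane) ∪ f, p = p₀ := fun p hp => by
      obtain ⟨r, rfl⟩ := hv p hp
      simp [hφ, h0]
    have ha := hp a (by simp [he])
    have hb := hp b (by simp [he])
    have hcc := hp c (by simp [hf])
    have hd := hp d (by simp [hf])
    have hef' : (e : Set Plane) = f := by rw [he, hf, ha, hb, hcc, hd]
    rw [← hef', Set.inter_self]
    exact hxe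
  · have hinj : Function.Injective φ := fun r s hrs => by
      rw [hφ, hφ] at hrs
      exact smul_left_injective ℝ h0 (by simpa using hrs)
    obtain ⟨α, β, hαβ, he'⟩ : ∃ α β, α ≤ β ∧ (e : Set Plane) = {φ α, φ β} := by
      obtain ⟨α, rfl⟩ := hv a (by simp [he])
      obtain ⟨β, rfl⟩ := hv b (by simp [he])
      rcases le_total α β with h | h
      · exact ⟨α, β, h, he⟩
      · exact ⟨β, α, h, by rw [he, Set.pair_comm]⟩
    obtain ⟨γ, δ, hγδ, hf'⟩ : ∃ α β, α ≤ β ∧ (f : Set Plane) = {φ α, φ β} := by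
      obtain ⟨α, rfl⟩ := hv c (by simp [hf])
      obtain ⟨β, rfl⟩ := hv d (by simp [hf])
      rcases le_total α β with h | h
      · exact ⟨α, β, h, hf⟩
      · exact ⟨β, α, h, by rw [hf, Set.pair_comm]⟩
    rcases le_total α γ with h | h
    · exact glue_of_ordered hinj he' hf' hαβ hγδ h hef hfe hxe hxf
    · rw [Set.inter_comm]
      exact glue_of_ordered hinj hf' he' hγδ hαβ h hfe hef hxf hxe

/-- A level set of a nonzero linear form on the plane is a line. -/
lemma collinear_of_linear_eq {g : Plane →L[ℝ] ℝ} (hg : g ≠ 0) {u : ℝ} {s : Set Plane}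
    (hs : ∀ p ∈ s, g p = u) : Collinear ℝ s := by
  have h1 : vectorSpan ℝ s ≤ LinearMap.ker (g : Plane →ₗ[ℝ] ℝ) := by
    rw [vectorSpan, Submodule.span_le]
    rintro _ ⟨p, hp, q, hq, rfl⟩
    simp [hs p hp, hs q hq]
  have h2 : Module.finrank ℝ (LinearMap.ker (g : Plane →ₗ[ℝ] ℝ)) < 2 := by
    have := Submodule.finrank_lt (s := LinearMap.ker (g : Plane →ₗ[ℝ] ℝ)) (fun h => hg (by
      ext1 x; have : x ∈ LinearMap.ker (g : Plane →ₗ[ℝ] ℝ) := by rw [h]; trivial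
      simpa using this))
    simpa using this
  rw [collinear_iff_finrank_le_one]
  exact (Submodule.finrank_mono h1).trans (by omega)

/-! ### Generic points -/

/-- A point is generic for `P` if it lies on no line through two points of `P`. -/
def Generic (P : Finset Plane) (x : Plane) : Prop :=
  ∀ p ∈ P, ∀ q ∈ P, p ≠ q → x ∉ line[ℝ, p, q]


lemma line_ne_top (p q : Plane) : line[ℝ, p, q] ≠ ⊤ := fun h => by
  have h1 := collinear_pair ℝ p q
  rw [collinear_iff_finrank_le_one, ← direction_affineSpan, h, AffineSubspace.direction_top,
    finrank_top] at h1
  simp at h1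

/-- Generic points are dense, as the lines through two points of `P` are null sets. -/
lemma exists_generic (P : Finset Plane) {U : Set Plane} (hU : IsOpen U) (hne : U.Nonempty) :
    ∃ x ∈ U, Generic P x := by
  by_contra! h
  have hsub : U ⊆ ⋃ p ∈ (P : Set Plane), ⋃ q ∈ (P : Set Plane), ⋃ (_ : p ≠ q),
      (line[ℝ, p, q] : Set Plane) := fun x hx => by
    have := h x hx
    simp only [Generic, not_forall, not_not] at this
    obtain ⟨p, hp, q, hq, hpq, hx⟩ := this
    simp only [Set.mem_iUnion]
    exact ⟨p, hp, q, hq, hpq, hx⟩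
  have h0 : MeasureTheory.volume
      (⋃ p ∈ (P : Set Plane), ⋃ q ∈ (P : Set Plane), ⋃ (_ : p ≠ q),
        (line[ℝ, p, q] : Set Plane)) = 0 := by
    rw [MeasureTheory.measure_biUnion_null_iff P.countable_toSet]
    intro p _
    rw [MeasureTheory.measure_biUnion_null_iff P.countable_toSet]
    intro q _
    rw [MeasureTheory.measure_iUnion_null_iff]
    intro _
    exact MeasureTheory.Measure.addHaar_affineSubspace _ _ (line_ne_top p q)
  exact (hU.measure_pos MeasureTheory.volume hne).ne' (MeasureTheory.measure_mono_null hsub h0)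

lemma Generic.notMem_convexHull {x : Plane} (hx : Generic P x) (hP : 2 ≤ P.card)
    {f : Finset Plane} (hf : f ⊆ P) (hf2 : f.card ≤ 2) : x ∉ convexHull ℝ (f : Set Plane) := by
  classical
  obtain ⟨g, hfg, hgP, hg⟩ := Finset.exists_subsuperset_card_eq hf hf2 hP
  obtain ⟨p, q, hpq, rfl⟩ := Finset.card_eq_two.1 hg
  intro h
  refine hx p (hgP (by simp)) q (hgP (by simp)) hpq ?_
  refine convexHull_subset_affineSpan _ (convexHull_mono (t := ({p, q} : Set Plane)) ?_ h)
  simpa using Finset.coe_subset.2 hfg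

lemma IsTriangle.two_le_card (ht : IsTriangle t) (htP : t ⊆ P) : 2 ≤ P.card := by
  have := Finset.card_le_card htP
  rw [ht.1] at this
  omega

lemma Generic.bary_pos {x : Plane} (hx : Generic P x) (ht : IsTriangle t) (htP : t ⊆ P)
    (hxt : x ∈ convexHull ℝ (t : Set Plane)) {v : Plane} (hv : v ∈ t) : 0 < bary t v x := by
  classical
  refine lt_of_le_of_ne (ht.bary_nonneg hxt hv) fun h0 => ?_
  refine hx.notMem_convexHull (ht.two_le_card htP) (f := t.erase v)
    ((Finset.erase_subset _ _).trans htP) (by rw [Finset.card_erase_of_mem hv, ht.1])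
    (ht.mem_convexHull_sub (Finset.erase_subset _ _) (fun w hw => ht.bary_nonneg hxt hw)
      fun w hw hwv => ?_)
  obtain rfl : w = v := by simpa [hw] using hwv
  exact h0.symm

lemma Generic.ne {x : Plane} (hx : Generic P x) (hP : 2 ≤ P.card) {p : Plane} (hp : p ∈ P) :
    x ≠ p := by
  rintro rfl
  exact hx.notMem_convexHull hP (f := {x}) (by simpa using hp) (by simp) (by simp)

/-! ### Tilings -/

/-- The sets of triangles of the triangulations of a noncollinear set `P`: triangles with vertices
in `P`, containing no other point of `P`, such that each generic point of the convex hull of `P`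
lies in exactly one of them. -/
structure IsTiling (P : Finset Plane) (T : Finset (Finset Plane)) : Prop where
  subset : ∀ t ∈ T, t ⊆ P
  isTriangle : ∀ t ∈ T, IsTriangle t
  empty : ∀ t ∈ T, ∀ p ∈ P, p ∈ convexHull ℝ (t : Set Plane) → p ∈ t
  cover : ∀ x, Generic P x → x ∈ convexHull ℝ (P : Set Plane) →
    ∃ t ∈ T, x ∈ convexHull ℝ (t : Set Plane)
  unique : ∀ x, Generic P x → ∀ s ∈ T, ∀ t ∈ T, x ∈ convexHull ℝ (s : Set Plane) →
    x ∈ convexHull ℝ (t : Set Plane) → s = t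


/-- Density of the generic points: a closed finite union covering them covers the hull. -/
lemma mem_of_generic_cover (hP : affineSpan ℝ (P : Set Plane) = ⊤)
    (cover : ∀ x, Generic P x → x ∈ convexHull ℝ (P : Set Plane) →
      ∃ t ∈ T, x ∈ convexHull ℝ (t : Set Plane)) {x : Plane}
    (hx : x ∈ convexHull ℝ (P : Set Plane)) : ∃ t ∈ T, x ∈ convexHull ℝ (t : Set Plane) := by
  have hne := interior_convexHull_nonempty_iff_affineSpan_eq_top.2 hP
  have hcl := (convex_convexHull ℝ (P : Set Plane)).closure_interior_eq_closure_of_nonempty_interior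
    hne
  have hx' : x ∈ closure (interior (convexHull ℝ (P : Set Plane))) :=
    hcl ▸ subset_closure hx
  have hclosed : IsClosed (⋃ t ∈ T, convexHull ℝ (t : Set Plane)) :=
    Set.Finite.isClosed_biUnion T.finite_toSet fun t _ => IsTriangle.isClosed t
  have hsub : interior (convexHull ℝ (P : Set Plane)) ⊆ ⋃ t ∈ T, convexHull ℝ (t : Set Plane) := by
    intro y hy
    by_contra hyn
    obtain ⟨z, ⟨hz1, hz2⟩, hz⟩ := exists_generic P (isOpen_interior.inter hclosed.isOpen_compl)
      ⟨y, hy, hyn⟩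
    obtain ⟨t, ht, hzt⟩ := cover z hz (interior_subset hz1)
    exact hz2 (Set.mem_biUnion ht hzt)
  simpa using closure_minimal hsub hclosed hx'

lemma IsTiling.exists_mem (hT : IsTiling P T) (hP : affineSpan ℝ (P : Set Plane) = ⊤) {x : Plane}
    (hx : x ∈ convexHull ℝ (P : Set Plane)) : ∃ t ∈ T, x ∈ convexHull ℝ (t : Set Plane) :=
  mem_of_generic_cover hP hT.cover hx

/-- A point of a convex hull at which a linear form attains its maximum is in the convex hull of the
points where the maximum is attained. -/
lemma mem_convexHull_filter (g : Plane →L[ℝ] ℝ) (u : ℝ) (s : Finset Plane) (hs : ∀ p ∈ s, g p ≤ u)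
    {x : Plane} (hx : x ∈ convexHull ℝ (s : Set Plane)) (hxu : g x = u) :
    x ∈ convexHull ℝ ((s.filter fun p => g p = u : Finset Plane) : Set Plane) := by
  rw [Finset.mem_convexHull'] at hx
  obtain ⟨w, hw0, hw1, rfl⟩ := hx
  have h0 : ∀ p ∈ s, w p * (u - g p) = 0 := by
    rw [← Finset.sum_eq_zero_iff_of_nonneg fun p hp =>
      mul_nonneg (hw0 p hp) (sub_nonneg.2 (hs p hp))]
    simp only [mul_sub, Finset.sum_sub_distrib, ← Finset.sum_mul, hw1]
    simp only [map_sum, map_smul, smul_eq_mul] at hxu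
    rw [hxu]; ring
  have hz : ∀ p ∈ s, p ∉ s.filter (fun p => g p = u) → w p = 0 := fun p hp hp' => by
    have : g p ≠ u := fun h => hp' (by simp [hp, h])
    exact (mul_eq_zero.1 (h0 p hp)).resolve_right (sub_ne_zero.2 this.symm)
  rw [← Finset.sum_subset (Finset.filter_subset (fun p => g p = u) s)
    fun p hp hp' => by rw [hz p hp hp', zero_smul]]
  rw [← Finset.sum_subset (Finset.filter_subset (fun p => g p = u) s) hz] at hw1
  exact (convex_convexHull ℝ _).sum_mem (fun p hp => hw0 p (Finset.mem_filter.1 hp).1) hw1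
    fun p hp => subset_convexHull ℝ _ hp

/-- The points of a triangle on a level line of a linear form bounding it are at most two. -/
lemma IsTriangle.card_filter_le (ht : IsTriangle t) {g : Plane →L[ℝ] ℝ} (hg : g ≠ 0) (u : ℝ) :
    (t.filter fun p => g p = u).card ≤ 2 := by
  by_contra! h
  have heq : (t.filter fun p => g p = u) = t :=
    Finset.eq_of_subset_of_card_le (Finset.filter_subset _ _) (by rw [ht.1]; omega)
  have hc : Collinear ℝ (t : Set Plane) := collinear_of_linear_eq hg (u := u) fun p hp => by
    rw [Finset.mem_coe, ← heq] at hp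
    exact (Finset.mem_filter.1 hp).2
  have h1 := ht.basis.tot
  have h2 : Set.range ht.basis = (t : Set Plane) := by simp [ht.coe_basis]
  rw [h2] at h1
  rw [collinear_iff_finrank_le_one, ← direction_affineSpan, h1, AffineSubspace.direction_top,
    finrank_top] at hc
  simp at hc

/-- The triangles of a tiling meet in common faces: two distinct ones have disjoint interiors, hence
are separated by a line, and on that line there are only faces with at most two vertices. -/
lemma IsTiling.glue (hT : IsTiling P T) {s t : Finset Plane} (hs : s ∈ T) (ht : t ∈ T) {x : Plane}
    (hxs : x ∈ convexHull ℝ (s : Set Plane)) (hxt : x ∈ convexHull ℝ (t : Set Plane)) :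
    x ∈ convexHull ℝ ((s : Set Plane) ∩ t) := by
  by_cases hst : s = t
  · subst hst; simpa using hxs
  have hs' := hT.isTriangle s hs
  have ht' := hT.isTriangle t ht
  have hdisj : Disjoint (interior (convexHull ℝ (s : Set Plane)))
      (interior (convexHull ℝ (t : Set Plane))) := by
    rw [Set.disjoint_iff_inter_eq_empty]
    by_contra hne
    obtain ⟨y, ⟨hy1, hy2⟩, hy⟩ := exists_generic P (isOpen_interior.inter isOpen_interior)
      (Set.nonempty_iff_ne_empty.2 hne)
    exact hst (hT.unique y hy s hs t ht (interior_subset hy1) (interior_subset hy2))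
  obtain ⟨g, u, hgs, hgt⟩ := geometric_hahn_banach_open_open
    (convex_convexHull ℝ (s : Set Plane)).interior isOpen_interior
    (convex_convexHull ℝ (t : Set Plane)).interior isOpen_interior hdisj
  have hg : g ≠ 0 := by
    rintro rfl
    obtain ⟨y, hy⟩ := hs'.nonempty_interior
    obtain ⟨z, hz⟩ := ht'.nonempty_interior
    exact lt_asymm (hgs y hy) (hgt z hz)
  have hcl : ∀ {r : Finset Plane}, IsTriangle r → convexHull ℝ (r : Set Plane) ⊆
      closure (interior (convexHull ℝ (r : Set Plane))) := fun {r} hr => by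
    rw [(convex_convexHull ℝ (r : Set Plane)).closure_interior_eq_closure_of_nonempty_interior
      hr.nonempty_interior]
    exact subset_closure
  have hgs' : ∀ y ∈ convexHull ℝ (s : Set Plane), g y ≤ u := fun y hy =>
    closure_minimal (s := interior (convexHull ℝ (s : Set Plane))) (t := {y | g y ≤ u})
      (fun z hz => (hgs z hz).le) (isClosed_le g.continuous continuous_const) (hcl hs' hy)
  have hgt' : ∀ y ∈ convexHull ℝ (t : Set Plane), u ≤ g y := fun y hy =>
    closure_minimal (s := interior (convexHull ℝ (t : Set Plane))) (t := {y | u ≤ g y})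
      (fun z hz => (hgt z hz).le) (isClosed_le continuous_const g.continuous) (hcl ht' hy)
  have hxu : g x = u := le_antisymm (hgs' x hxs) (hgt' x hxt)
  have h1 := mem_convexHull_filter g u s (fun p hp => hgs' p (subset_convexHull ℝ _ hp)) hxs hxu
  have h2 := mem_convexHull_filter (-g) (-u) t
    (fun p hp => neg_le_neg (hgt' p (subset_convexHull ℝ _ hp))) hxt (by simp [hxu])
  simp only [neg_apply, neg_inj] at h2
  have key := glue_of_collinear (e := s.filter fun p => g p = u) (f := t.filter fun p => g p = u)
    (collinear_of_linear_eq hg (u := u) fun p hp => by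
      rcases hp with hp | hp <;> exact (Finset.mem_filter.1 hp).2)
    (hs'.card_filter_le hg u) (ht'.card_filter_le hg u)
    (fun p hp hp' => by
      rw [Finset.mem_filter] at hp ⊢
      exact ⟨hT.empty s hs p (hT.subset t ht hp.1)
        (convexHull_mono (Finset.coe_subset.2 (Finset.filter_subset _ _)) hp'), hp.2⟩)
    (fun p hp hp' => by
      rw [Finset.mem_filter] at hp ⊢
      exact ⟨hT.empty t ht p (hT.subset s hs hp.1)
        (convexHull_mono (Finset.coe_subset.2 (Finset.filter_subset _ _)) hp'), hp.2⟩) h1 h2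
  exact convexHull_mono (Set.inter_subset_inter (Finset.coe_subset.2 (Finset.filter_subset _ _))
    (Finset.coe_subset.2 (Finset.filter_subset _ _))) key

/-! ### Existence of a tiling -/

lemma affineIndependent_card_le {f : Finset Plane}
    (hf : AffineIndependent ℝ ((↑) : f → Plane)) : f.card ≤ 3 := by
  have h1 := hf.card_le_finrank_succ
  have h2 := Submodule.finrank_le (vectorSpan ℝ (Set.range ((↑) : f → Plane)))
  have h3 : Module.finrank ℝ Plane = 2 := by simp
  rw [Fintype.card_coe] at h1
  omega

/-- Carathéodory's theorem at a generic point. -/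
lemma Generic.exists_isTriangle {x : Plane} (hx : Generic P x) (hP : 2 ≤ P.card)
    {f : Finset Plane} (hf : f ⊆ P) (hxf : x ∈ convexHull ℝ (f : Set Plane)) :
    ∃ t ⊆ f, IsTriangle t ∧ x ∈ convexHull ℝ (t : Set Plane) := by
  rw [convexHull_eq_union] at hxf
  simp only [Set.mem_iUnion] at hxf
  obtain ⟨t, htf, hind, hxt⟩ := hxf
  have htf' : t ⊆ f := Finset.coe_subset.1 htf
  refine ⟨t, htf', ⟨?_, hind⟩, hxt⟩
  have h1 := affineIndependent_card_le hind
  by_contra h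
  exact hx.notMem_convexHull hP (htf'.trans hf) (by omega) hxt

/-- Steinitz exchange: a point inside a triangle stays in the hull when a suitable vertex is
replaced by a given point. -/
lemma IsTriangle.exchange [DecidableEq Plane] (ht : IsTriangle t) {x : Plane}
    (hx : ∀ v ∈ t, 0 < bary t v x) (q : Plane) :
    ∃ v ∈ t, x ∈ convexHull ℝ ((insert q (t.erase v) : Finset Plane) : Set Plane) := by
  have hne : (t.filter fun v => 0 < bary t v q).Nonempty := by
    by_contra h
    rw [Finset.not_nonempty_iff_eq_empty, Finset.filter_eq_empty_iff] at h
    have := Finset.sum_nonpos fun v hv => not_lt.1 (h hv)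
    rw [ht.sum_bary] at this
    linarith
  obtain ⟨v₀, hv₀, hmin⟩ := Finset.exists_min_image _ (fun v => bary t v x / bary t v q) hne
  rw [Finset.mem_filter] at hv₀
  set ρ := bary t v₀ x / bary t v₀ q with hρ
  have hρ0 : 0 < ρ := div_pos (hx v₀ hv₀.1) hv₀.2
  have hw : ∀ v ∈ t, 0 ≤ bary t v x - ρ * bary t v q := fun v hv => by
    by_cases h : 0 < bary t v q
    · have := hmin v (Finset.mem_filter.2 ⟨hv, h⟩)
      rw [le_div_iff₀ h] at this
      linarith
    · have := mul_nonneg hρ0.le (neg_nonneg.2 (not_lt.1 h))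
      have := hx v hv
      linarith
  have hw0 : bary t v₀ x - ρ * bary t v₀ q = 0 := by
    rw [hρ, div_mul_cancel₀ _ hv₀.2.ne', sub_self]
  have hsum : ∑ v ∈ t.erase v₀, (bary t v x - ρ * bary t v q) = 1 - ρ := by
    have := Finset.add_sum_erase t (fun v => bary t v x - ρ * bary t v q) hv₀.1
    simp only [hw0, zero_add] at this
    rw [this, Finset.sum_sub_distrib, ← Finset.mul_sum, ht.sum_bary, ht.sum_bary, mul_one]
  have hvec : ∑ v ∈ t.erase v₀, (bary t v x - ρ * bary t v q) • v = x - ρ • q := by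
    have := Finset.add_sum_erase t (fun v => (bary t v x - ρ * bary t v q) • v) hv₀.1
    simp only [hw0, zero_add, zero_smul] at this
    rw [this]
    simp only [sub_smul, Finset.sum_sub_distrib, mul_smul, ← Finset.smul_sum, ht.sum_bary_smul]
  refine ⟨v₀, hv₀.1, ?_⟩
  have hmem := (convex_convexHull ℝ ((insert q (t.erase v₀) : Finset Plane) : Set Plane)).sum_mem
    (t := Finset.univ) (w := fun o : Option (t.erase v₀) => o.elim ρ
      fun v => bary t v x - ρ * bary t v q) (z := fun o => o.elim q fun v => (v : Plane))
    (by
      rintro (_ | v) -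
      · exact hρ0.le
      · exact hw v (Finset.mem_of_mem_erase v.2))
    (by
      rw [Fintype.sum_option]
      simp only [Option.elim]
      rw [Finset.sum_coe_sort (t.erase v₀) fun v => bary t v x - ρ * bary t v q, hsum]
      ring)
    (by
      rintro (_ | v) -
      · exact subset_convexHull ℝ _ (by simp)
      · exact subset_convexHull ℝ _ (Finset.mem_insert_of_mem v.2))
  rw [Fintype.sum_option] at hmem
  simp only [Option.elim] at hmem
  rw [Finset.sum_coe_sort (t.erase v₀) fun v => (bary t v x - ρ * bary t v q) • v, hvec,
    add_sub_cancel] at hmem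
  exact hmem

/-- Two triangles of a lower hull over the same generic point lie in the same supporting plane. -/
lemma lift_eq_of_generic {ψ : Plane → ℝ} {s t : Finset Plane} (hs : IsTriangle s)
    (ht : IsTriangle t) (hsP : s ⊆ P) (htP : t ⊆ P) (hsψ : ∀ q ∈ P, lift ψ s q ≤ ψ q)
    (htψ : ∀ q ∈ P, lift ψ t q ≤ ψ q) {x : Plane} (hx : Generic P x)
    (hxs : x ∈ convexHull ℝ (s : Set Plane)) (hxt : x ∈ convexHull ℝ (t : Set Plane)) :
    lift ψ s = lift ψ t := by
  have key : ∀ {a b : Finset Plane}, IsTriangle a → a ⊆ P → (∀ q ∈ P, lift ψ b q ≤ ψ q) →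
      x ∈ convexHull ℝ (a : Set Plane) → lift ψ b x ≤ lift ψ a x := fun {a b} ha haP hb hxa => by
    rw [ha.affineMap_apply (lift ψ b), lift_apply]
    exact Finset.sum_le_sum fun v hv => mul_le_mul_of_nonneg_left (hb v (haP hv))
      (ha.bary_nonneg hxa hv)
  have heq : lift ψ t x = lift ψ s x := le_antisymm (key hs hsP htψ hxs) (key ht htP hsψ hxt)
  refine hs.affineMap_ext fun v hv => ?_
  rw [hs.lift_vertex ψ hv]
  have h0 : ∑ v ∈ s, bary s v x * (ψ v - lift ψ t v) = 0 := by
    simp only [mul_sub, Finset.sum_sub_distrib]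
    rw [← lift_apply, ← hs.affineMap_apply, heq, sub_self]
  rw [Finset.sum_eq_zero_iff_of_nonneg fun v hv =>
    mul_nonneg (hs.bary_nonneg hxs hv) (sub_nonneg.2 (htψ v (hsP hv)))] at h0
  have := (mul_eq_zero.1 (h0 v hv)).resolve_left (hx.bary_pos hs hsP hxs hv).ne'
  linarith

open scoped Classical in
/-- The triangles in `P` over which the lower hull of the graph of `ψ` on `P` is flat. -/
def regularTriangles (P : Finset Plane) (ψ : Plane → ℝ) : Finset (Finset Plane) :=
  P.powerset.filter fun t => IsTriangle t ∧ ∀ q ∈ P, lift ψ t q ≤ ψ q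

lemma mem_regularTriangles {ψ : Plane → ℝ} :
    t ∈ regularTriangles P ψ ↔ t ⊆ P ∧ IsTriangle t ∧ ∀ q ∈ P, lift ψ t q ≤ ψ q := by
  simp [regularTriangles]

/-- The lower hull of a lifting in general and convex position projects to a tiling. -/
lemma isTiling_regularTriangles (hP : affineSpan ℝ (P : Set Plane) = ⊤) {ψ : Plane → ℝ}
    (hgen : ∀ t ⊆ P, IsTriangle t → ∀ q ∈ P, q ∉ t → lift ψ t q ≠ ψ q)
    (hconv : ∀ t ⊆ P, IsTriangle t → ∀ q ∈ P, q ∉ t → q ∈ convexHull ℝ (t : Set Plane) →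
      ψ q < lift ψ t q) :
    IsTiling P (regularTriangles P ψ) where
  subset t ht := (mem_regularTriangles.1 ht).1
  isTriangle t ht := (mem_regularTriangles.1 ht).2.1
  empty t ht p hp hpt := by
    obtain ⟨h1, h2, h3⟩ := mem_regularTriangles.1 ht
    by_contra hn
    exact absurd (h3 p hp) (not_le.2 (hconv t h1 h2 p hp hn hpt))
  unique x hx s hs t ht hxs hxt := by
    obtain ⟨hsP, hs', hsψ⟩ := mem_regularTriangles.1 hs
    obtain ⟨htP, ht', htψ⟩ := mem_regularTriangles.1 ht
    have heq := lift_eq_of_generic hs' ht' hsP htP hsψ htψ hx hxs hxt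
    refine Finset.eq_of_subset_of_card_le (fun v hv => ?_) (by rw [hs'.1, ht'.1])
    by_contra hn
    refine hgen t htP ht' v (hsP hv) hn ?_
    rw [← heq, hs'.lift_vertex ψ hv]
  cover x hx hxP := by
    classical
    have hcard : 2 ≤ P.card := by
      by_contra h
      have hc : Collinear ℝ (P : Set Plane) := by
        have hsub : (P : Set Plane).Subsingleton := by
          rw [← Finset.card_le_one_iff_subsingleton]; omega
        exact hsub.induction_on (collinear_empty ℝ _) (collinear_singleton ℝ)
      rw [collinear_iff_finrank_le_one, ← direction_affineSpan, hP, AffineSubspace.direction_top,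
        finrank_top] at hc
      simp at hc
    -- of all triangles in `P` over `x`, take the one whose plane is lowest at `x`
    obtain ⟨t₀, ht₀P, ht₀, hxt₀⟩ := hx.exists_isTriangle hcard subset_rfl hxP
    obtain ⟨t, ht, hmin⟩ := Finset.exists_min_image
      (P.powerset.filter fun t => IsTriangle t ∧ x ∈ convexHull ℝ (t : Set Plane))
      (fun t => lift ψ t x) ⟨t₀, by simp [ht₀P, ht₀, hxt₀]⟩
    simp only [Finset.mem_filter, Finset.mem_powerset] at ht hmin
    obtain ⟨htP, ht', hxt⟩ := ht
    refine ⟨t, mem_regularTriangles.2 ⟨htP, ht', fun q hq => ?_⟩, hxt⟩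
    by_contra! hlt
    have hqt : q ∉ t := fun h => by rw [ht'.lift_vertex ψ h] at hlt; exact lt_irrefl _ hlt
    obtain ⟨v, hv, hxv⟩ := ht'.exchange (fun v hv => hx.bary_pos ht' htP hxt hv) q
    have hsubP : insert q (t.erase v) ⊆ P :=
      Finset.insert_subset hq ((Finset.erase_subset _ _).trans htP)
    obtain ⟨s, hsub, hs, hxs⟩ := hx.exists_isTriangle hcard hsubP hxv
    have hs_eq : s = insert q (t.erase v) := Finset.eq_of_subset_of_card_le hsub (by
      rw [hs.1, Finset.card_insert_of_notMem (fun h => hqt (Finset.mem_of_mem_erase h)),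
        Finset.card_erase_of_mem hv, ht'.1])
    have hle := hmin s ⟨hsub.trans hsubP, hs, hxs⟩
    have hqs : q ∈ s := by rw [hs_eq]; simp
    refine absurd hle (not_le.2 ?_)
    rw [lift_apply, hs.affineMap_apply (lift ψ t)]
    refine Finset.sum_lt_sum (fun w hw => mul_le_mul_of_nonneg_left ?_ (hs.bary_nonneg hxs hw))
      ⟨q, hqs, mul_lt_mul_of_pos_left hlt (hx.bary_pos hs (hsub.trans hsubP) hxs hqs)⟩
    rw [hs_eq, Finset.mem_insert] at hw
    rcases hw with rfl | hw
    · exact hlt.le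
    · rw [ht'.lift_vertex ψ (Finset.mem_of_mem_erase hw)]

/-- The lifting function of the paraboloid. -/
def sq (p : Plane) : ℝ := ‖p‖ ^ 2

/-- The power of a point with respect to the circumcircle of `t`, in barycentric coordinates. -/
lemma IsTriangle.lift_sq_sub (ht : IsTriangle t) (q : Plane) :
    lift sq t q - sq q = ∑ v ∈ t, bary t v q * ‖v - q‖ ^ 2 := by
  have h1 : ∀ v, ‖v - q‖ ^ 2 = sq v - 2 * inner ℝ v q + sq q := fun v => norm_sub_sq_real v q
  have h2 : ∑ v ∈ t, bary t v q * inner ℝ v q = sq q := by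
    have := congrArg (fun y => inner ℝ y q) (ht.sum_bary_smul q)
    simp only [sum_inner, inner_smul_left, real_inner_self_eq_norm_sq] at this
    simpa [sq] using this
  have h3 : ∑ v ∈ t, bary t v q * sq q = sq q := by rw [← Finset.sum_mul, ht.sum_bary, one_mul]
  have h4 : ∑ v ∈ t, bary t v q * (2 * inner ℝ v q) = 2 * sq q := by
    rw [← h2, Finset.mul_sum]; exact Finset.sum_congr rfl fun v _ => by ring
  simp only [h1, mul_add, mul_sub, Finset.sum_add_distrib, Finset.sum_sub_distrib]
  rw [h3, h4, lift_apply]; ring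

/-- Strict convexity of the paraboloid. -/
lemma IsTriangle.sq_lt_lift (ht : IsTriangle t) {q : Plane} (hq : q ∉ t)
    (hqt : q ∈ convexHull ℝ (t : Set Plane)) : sq q < lift sq t q := by
  rw [← sub_pos, ht.lift_sq_sub]
  have hpos : ∀ v ∈ t, 0 < ‖v - q‖ ^ 2 := fun v hv => by
    have : v - q ≠ 0 := sub_ne_zero.2 fun h => hq (h ▸ hv)
    positivity
  obtain ⟨v, hv, hv0⟩ : ∃ v ∈ t, 0 < bary t v q := by
    by_contra! h
    have := Finset.sum_nonpos h
    rw [ht.sum_bary] at this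
    linarith
  exact Finset.sum_pos' (fun w hw => mul_nonneg (ht.bary_nonneg hqt hw) (hpos w hw).le)
    ⟨v, hv, mul_pos hv0 (hpos v hv)⟩

/-- The height of the lift of `q` below the plane through the lifts of the vertices of `t`, as a
linear form in the lifting function. -/
def liftGap (t : Finset Plane) (q : Plane) : (Plane → ℝ) →ₗ[ℝ] ℝ :=
  ∑ v ∈ t, bary t v q • (LinearMap.proj v : (Plane → ℝ) →ₗ[ℝ] ℝ) - LinearMap.proj q

lemma liftGap_apply (t : Finset Plane) (q : Plane) (ψ : Plane → ℝ) :
    liftGap t q ψ = lift ψ t q - ψ q := by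
  simp [liftGap, lift_apply]

/-- Some lifting of `P` has no point in the plane of three others: the liftings excluded by one such
coincidence form a proper subspace. -/
lemma exists_generic_lifting (P : Finset Plane) :
    ∃ w : Plane → ℝ, ∀ t ⊆ P, ∀ q ∈ P, q ∉ t → liftGap t q w ≠ 0 := by
  classical
  set I : Finset (Finset Plane × Plane) := (P.powerset ×ˢ P).filter fun i => i.2 ∉ i.1 with hI
  have htop : (⊤ : Submodule ℝ (Plane → ℝ)) ∉ I.image fun i => LinearMap.ker (liftGap i.1 i.2) := by
    rw [Finset.mem_image]
    rintro ⟨⟨t, q⟩, hi, h⟩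
    have hq : q ∉ t := (Finset.mem_filter.1 hi).2
    have : Pi.single q (1 : ℝ) ∈ LinearMap.ker (liftGap t q) := by
      rw [h]; trivial
    rw [LinearMap.mem_ker, liftGap_apply, lift_apply, Finset.sum_eq_zero fun v hv => by
      rw [Pi.single_eq_of_ne (ne_of_mem_of_not_mem hv hq), mul_zero]] at this
    simp at this
  have := Subspace.biUnion_ne_univ_of_top_notMem htop
  rw [Ne, Set.eq_univ_iff_forall, not_forall] at this
  obtain ⟨w, hw⟩ := this
  refine ⟨w, fun t ht q hq hqt h0 => hw ?_⟩
  simp only [Set.mem_iUnion, Finset.mem_image]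
  exact ⟨_, ⟨(t, q), by simp [hI, ht, hq, hqt], rfl⟩, h0⟩

/-- A noncollinear finite set has a tiling: a small generic perturbation of the paraboloid gives a
lifting in general and convex position. -/
lemma exists_isTiling (hP : affineSpan ℝ (P : Set Plane) = ⊤) : ∃ T, IsTiling P T := by
  classical
  obtain ⟨w, hw⟩ := exists_generic_lifting P
  have hcont : ∀ t q, Filter.Tendsto (fun ε : ℝ => liftGap t q (sq + ε • w))
      (nhdsWithin 0 (Set.Ioi 0))
      (nhds (liftGap t q sq)) := fun t q => by
    have : Continuous fun ε : ℝ => liftGap t q (sq + ε • w) := by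
      simp only [map_add, map_smul, smul_eq_mul]; fun_prop
    simpa using this.continuousAt.tendsto.mono_left (nhdsWithin_le_nhds (a := (0 : ℝ)))
  have hev : ∀ᶠ ε : ℝ in nhdsWithin 0 (Set.Ioi 0), ∀ t ∈ P.powerset, ∀ q ∈ P, q ∉ t →
      liftGap t q (sq + ε • w) ≠ 0 ∧ (0 < liftGap t q sq → 0 < liftGap t q (sq + ε • w)) := by
    rw [Filter.eventually_all_finset]
    intro t ht
    rw [Filter.eventually_all_finset]
    intro q hq
    rw [Filter.eventually_imp_distrib_left]
    intro hqt
    refine Filter.Eventually.and ?_ ?_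
    · by_cases h0 : liftGap t q sq = 0
      · filter_upwards [self_mem_nhdsWithin] with ε hε
        simp only [map_add, map_smul, smul_eq_mul, h0, zero_add]
        exact mul_ne_zero (ne_of_gt hε) (hw t (Finset.mem_powerset.1 ht) q hq hqt)
      · exact (hcont t q).eventually_ne h0
    · rw [Filter.eventually_imp_distrib_left]
      intro h0
      exact (hcont t q).eventually (lt_mem_nhds h0)
  obtain ⟨ε, hε⟩ := hev.exists
  refine ⟨_, isTiling_regularTriangles hP (ψ := sq + ε • w) (fun t htP _ q hq hqt h => ?_)
    (fun t htP ht q hq hqt hqc => ?_)⟩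
  · refine (hε t (Finset.mem_powerset.2 htP) q hq hqt).1 ?_
    rw [liftGap_apply, h, sub_self]
  · have := (hε t (Finset.mem_powerset.2 htP) q hq hqt).2 (by
      rw [liftGap_apply, sub_pos]; exact ht.sq_lt_lift hqt hqc)
    rwa [liftGap_apply, sub_pos] at this

/-! ### Modifying and comparing tilings -/

/-- Replacing some triangles of a tiling by others that cover the same generic points. -/
lemma IsTiling.replace [DecidableEq (Finset Plane)] (hT : IsTiling P T)
    {X Y : Finset (Finset Plane)} (hX : X ⊆ T)
    (subset : ∀ t ∈ Y, t ⊆ P) (isTriangle : ∀ t ∈ Y, IsTriangle t)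
    (empty : ∀ t ∈ Y, ∀ p ∈ P, p ∈ convexHull ℝ (t : Set Plane) → p ∈ t)
    (unique : ∀ x, Generic P x → ∀ s ∈ Y, ∀ t ∈ Y, x ∈ convexHull ℝ (s : Set Plane) →
      x ∈ convexHull ℝ (t : Set Plane) → s = t)
    (hXY : ∀ x, Generic P x → ((∃ t ∈ X, x ∈ convexHull ℝ (t : Set Plane)) ↔
      ∃ t ∈ Y, x ∈ convexHull ℝ (t : Set Plane))) :
    IsTiling P ((T \ X) ∪ Y) where
  subset t ht := by
    rcases Finset.mem_union.1 ht with h | h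
    · exact hT.subset t (Finset.mem_sdiff.1 h).1
    · exact subset t h
  isTriangle t ht := by
    rcases Finset.mem_union.1 ht with h | h
    · exact hT.isTriangle t (Finset.mem_sdiff.1 h).1
    · exact isTriangle t h
  empty t ht := by
    rcases Finset.mem_union.1 ht with h | h
    · exact hT.empty t (Finset.mem_sdiff.1 h).1
    · exact empty t h
  cover x hx hxP := by
    obtain ⟨t, ht, hxt⟩ := hT.cover x hx hxP
    by_cases htX : t ∈ X
    · obtain ⟨s, hs, hxs⟩ := (hXY x hx).1 ⟨t, htX, hxt⟩
      exact ⟨s, Finset.mem_union_right _ hs, hxs⟩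
    · exact ⟨t, Finset.mem_union_left _ (Finset.mem_sdiff.2 ⟨ht, htX⟩), hxt⟩
  unique x hx s hs t ht hxs hxt := by
    have key : ∀ a ∈ T \ X, ∀ b ∈ Y, x ∈ convexHull ℝ (a : Set Plane) →
        x ∈ convexHull ℝ (b : Set Plane) → False := fun a ha b hb hxa hxb => by
      rw [Finset.mem_sdiff] at ha
      obtain ⟨c, hc, hxc⟩ := (hXY x hx).2 ⟨b, hb, hxb⟩
      exact ha.2 (hT.unique x hx a ha.1 c (hX hc) hxa hxc ▸ hc)
    rcases Finset.mem_union.1 hs with h | h <;> rcases Finset.mem_union.1 ht with h' | h'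
    · exact hT.unique x hx s (Finset.mem_sdiff.1 h).1 t (Finset.mem_sdiff.1 h').1 hxs hxt
    · exact (key s h t h' hxs hxt).elim
    · exact (key t h' s h hxt hxs).elim
    · exact unique x hx s h t h' hxs hxt

lemma IsTiling.disjoint_of_cover [DecidableEq (Finset Plane)] (hT : IsTiling P T)
    {X Y : Finset (Finset Plane)} (hX : X ⊆ T)
    (isTriangle : ∀ t ∈ Y, IsTriangle t)
    (hXY : ∀ x, Generic P x → ((∃ t ∈ X, x ∈ convexHull ℝ (t : Set Plane)) ↔
      ∃ t ∈ Y, x ∈ convexHull ℝ (t : Set Plane))) : Disjoint (T \ X) Y := by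
  rw [Finset.disjoint_left]
  intro t ht htY
  rw [Finset.mem_sdiff] at ht
  obtain ⟨x, hx, hxg⟩ := exists_generic P isOpen_interior (isTriangle t htY).nonempty_interior
  obtain ⟨c, hc, hxc⟩ := (hXY x hxg).2 ⟨t, htY, interior_subset hx⟩
  exact ht.2 (hT.unique x hxg t ht.1 c (hX hc) (interior_subset hx) hxc ▸ hc)

lemma affineMap_lineMap (f : Plane →ᵃ[ℝ] ℝ) (x q : Plane) (r : ℝ) :
    f (AffineMap.lineMap x q r) = (1 - r) * f x + r * f q := by
  rw [AffineMap.apply_lineMap, AffineMap.lineMap_apply]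
  simp only [vsub_eq_sub, smul_eq_mul, vadd_eq_add]
  ring

/-- An empty triangle all of whose edges are edges of triangles of a tiling belongs to the tiling:
otherwise a triangle of the tiling overlapping it has a vertex outside it, and an edge of the tiling
passes through the interior of that triangle. -/
lemma IsTiling.mem_of_edges [DecidableEq Plane] (hT : IsTiling P T) (htP : t ⊆ P)
    (ht : IsTriangle t)
    (hte : ∀ p ∈ P, p ∈ convexHull ℝ (t : Set Plane) → p ∈ t)
    (hedge : ∀ v ∈ t, ∃ s ∈ T, t.erase v ⊆ s) : t ∈ T := by
  obtain ⟨x, hx, hxg⟩ := exists_generic P isOpen_interior ht.nonempty_interior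
  rw [ht.interior_eq] at hx
  have hxt : x ∈ convexHull ℝ (t : Set Plane) := ht.mem_convexHull_iff.2 fun v hv => (hx v hv).le
  obtain ⟨s, hs, hxs⟩ := hT.cover x hxg (convexHull_mono (Finset.coe_subset.2 htP) hxt)
  have hs' := hT.isTriangle s hs
  by_cases hst : s ⊆ t
  · rwa [← Finset.eq_of_subset_of_card_le hst (by rw [hs'.1, ht.1])]
  exfalso
  obtain ⟨w, hw, hwt⟩ := Finset.not_subset.1 hst
  have hwc : w ∉ convexHull ℝ (t : Set Plane) := fun h => hwt (hte w (hT.subset s hs hw) h)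
  rw [ht.mem_convexHull_iff] at hwc
  push Not at hwc
  obtain ⟨v₁, hv₁, hv₁w⟩ := hwc
  -- the first zero of a barycentric coordinate on the way from `x` to `w`
  obtain ⟨v₀, hv₀, hmin⟩ := Finset.exists_min_image (t.filter fun v => bary t v w < 0)
    (fun v => bary t v x / (bary t v x - bary t v w)) ⟨v₁, by simp [hv₁, hv₁w]⟩
  rw [Finset.mem_filter] at hv₀
  have hpos : ∀ v ∈ t, bary t v w < 0 → 0 < bary t v x - bary t v w := fun v hv hvw => by
    have := hx v hv; linarith
  set r := bary t v₀ x / (bary t v₀ x - bary t v₀ w) with hr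
  have hr0 : 0 < r := div_pos (hx v₀ hv₀.1) (hpos v₀ hv₀.1 hv₀.2)
  have hr1 : r < 1 := by rw [hr, div_lt_one (hpos v₀ hv₀.1 hv₀.2)]; linarith [hv₀.2]
  set y := AffineMap.lineMap x w r with hy
  have hy0 : bary t v₀ y = 0 := by
    have h1 : r * (bary t v₀ x - bary t v₀ w) = bary t v₀ x :=
      div_mul_cancel₀ _ (hpos v₀ hv₀.1 hv₀.2).ne'
    rw [hy, affineMap_lineMap]; linarith
  have hynn : ∀ v ∈ t, 0 ≤ bary t v y := fun v hv => by
    rw [hy, affineMap_lineMap]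
    by_cases h : bary t v w < 0
    · have h1 := hmin v (Finset.mem_filter.2 ⟨hv, h⟩)
      rw [le_div_iff₀ (hpos v hv h)] at h1
      linarith
    · have h1 := mul_nonneg hr0.le (not_lt.1 h)
      have h2 := mul_nonneg (sub_pos.2 hr1).le (hx v hv).le
      linarith
  have hye : y ∈ convexHull ℝ ((t.erase v₀ : Finset Plane) : Set Plane) :=
    ht.mem_convexHull_sub (Finset.erase_subset _ _) hynn fun v hv hv' => by
      obtain rfl : v = v₀ := by simpa [hv] using hv'
      exact hy0
  have hys : ∀ u ∈ s, 0 < bary s u y := fun u hu => by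
    rw [hy, affineMap_lineMap]
    have h1 := mul_pos (sub_pos.2 hr1) (hxg.bary_pos hs' (hT.subset s hs) hxs hu)
    have h2 := mul_nonneg hr0.le (hs'.bary_nonneg (subset_convexHull ℝ _ hw) hu)
    linarith
  obtain ⟨s', hs'T, hes'⟩ := hedge v₀ hv₀.1
  have hyi := hT.glue hs hs'T (hs'.mem_convexHull_iff.2 fun u hu => (hys u hu).le)
    (convexHull_mono (Finset.coe_subset.2 hes') hye)
  rw [← Finset.coe_inter] at hyi
  have hss' : s ⊆ s' := fun u hu => by
    by_contra hn
    exact (hys u hu).ne' (hs'.bary_eq_zero Finset.inter_subset_left hyi hu fun h =>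
      hn (Finset.mem_inter.1 h).2)
  obtain rfl := Finset.eq_of_subset_of_card_le hss' (by rw [hs'.1, (hT.isTriangle s' hs'T).1])
  obtain ⟨u, hu, hue⟩ := Finset.exists_mem_notMem_of_card_lt_card (s := t.erase v₀) (t := s) (by
    rw [hs'.1, Finset.card_erase_of_mem hv₀.1, ht.1]; norm_num)
  exact (hys u hu).ne' (hs'.bary_eq_zero hes' hye hu hue)

/-! ### Locally Delaunay tilings are Delaunay -/

/-- A tiling all of whose pairs of adjacent triangles satisfy the Delaunay condition (relative to a
lifting function) is globally Delaunay. Walking from a generic point of a triangle towards `q`, the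
height at `q` of the plane of the current triangle never decreases, and at the end it is `ψ q`. -/
lemma IsTiling.lift_le_of_local [DecidableEq Plane] (hP : affineSpan ℝ (P : Set Plane) = ⊤)
    (hT : IsTiling P T)
    {ψ : Plane → ℝ} (hloc : ∀ t ∈ T, ∀ t' ∈ T, (t ∩ t').card = 2 → ∀ d ∈ t', lift ψ t d ≤ ψ d)
    (t₀ : Finset Plane) (ht₀ : t₀ ∈ T) (q : Plane) (hq : q ∈ P) : lift ψ t₀ q ≤ ψ q := by
  have ht₀' := hT.isTriangle t₀ ht₀
  have hcard := ht₀'.two_le_card (hT.subset t₀ ht₀)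
  obtain ⟨x, hx, hxg⟩ := exists_generic P isOpen_interior ht₀'.nonempty_interior
  replace hx := interior_subset hx
  set γ : ℝ →ᵃ[ℝ] Plane := AffineMap.lineMap x q with hγ
  have hγc : Continuous γ := AffineMap.lineMap_continuous
  set K : Set ℝ := ⋃ t ∈ T.filter (fun t => lift ψ t₀ q ≤ lift ψ t q),
    Set.Icc 0 1 ∩ γ ⁻¹' convexHull ℝ (t : Set Plane) with hK
  have hKc : IsCompact K := Finset.isCompact_biUnion _ fun t _ =>
    isCompact_Icc.inter_right ((IsTriangle.isClosed t).preimage hγc)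
  have hmemK : ∀ {s : ℝ} {t : Finset Plane}, t ∈ T → lift ψ t₀ q ≤ lift ψ t q → 0 ≤ s → s ≤ 1 →
      γ s ∈ convexHull ℝ (t : Set Plane) → s ∈ K := fun {s t} ht hle h0 h1 hs => by
    rw [hK]
    exact Set.mem_biUnion (Finset.mem_coe.2 (Finset.mem_filter.2 ⟨ht, hle⟩)) ⟨⟨h0, h1⟩, hs⟩
  have hKne : K.Nonempty := ⟨0, hmemK ht₀ le_rfl le_rfl zero_le_one (by simpa [hγ] using hx)⟩
  obtain ⟨σ, hσK, hσmax⟩ := hKc.exists_isGreatest hKne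
  have hσK' := hσK
  rw [hK] at hσK'
  simp only [Set.mem_iUnion, Finset.mem_filter] at hσK'
  obtain ⟨t, ⟨ht, hle⟩, ⟨hσ0, hσ1⟩, hyt⟩ := hσK'
  have ht' := hT.isTriangle t ht
  change γ σ ∈ convexHull ℝ (t : Set Plane) at hyt
  rcases hσ1.eq_or_lt with rfl | hσ1
  · have hqt : q ∈ t := hT.empty t ht q hq (by simpa [hγ] using hyt)
    rwa [ht'.lift_vertex ψ hqt] at hle
  exfalso
  set y := γ σ with hy
  have hline : ∀ (f : Plane →ᵃ[ℝ] ℝ) (s : ℝ),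
      (1 - σ) * f (γ s) = (1 - s) * f y + (s - σ) * f q := fun f s => by
    rw [hy, hγ, affineMap_lineMap, affineMap_lineMap]; ring
  have hle1 : ∀ᶠ s in nhdsWithin σ (Set.Ioi σ), σ < s ∧ s ≤ 1 := by
    filter_upwards [self_mem_nhdsWithin, nhdsWithin_le_nhds (Iio_mem_nhds hσ1)] with s h1 h2
    exact ⟨h1, le_of_lt h2⟩
  -- the walk leaves `t` through an edge at `y`
  obtain ⟨v, hv, hvy, -⟩ : ∃ v ∈ t, bary t v y = 0 ∧ bary t v q < 0 := by
    by_contra! h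
    have hev : ∀ᶠ s in nhdsWithin σ (Set.Ioi σ), ∀ v ∈ t, 0 ≤ bary t v (γ s) := by
      rw [Filter.eventually_all_finset]
      intro v hv
      rcases (ht'.bary_nonneg hyt hv).eq_or_lt with h0 | h0
      · filter_upwards [hle1] with s hs
        have h1 := hline (bary t v) s
        rw [← h0, mul_zero, zero_add] at h1
        have h2 := mul_nonneg (sub_pos.2 hs.1).le (h v hv h0.symm)
        rw [← h1] at h2
        exact nonneg_of_mul_nonneg_right h2 (sub_pos.2 hσ1)
      · have hc : Continuous fun s => bary t v (γ s) :=
          (bary t v).continuous_of_finiteDimensional.comp hγc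
        exact nhdsWithin_le_nhds ((hc.continuousAt.eventually (lt_mem_nhds h0)).mono
          fun s hs => le_of_lt hs)
    obtain ⟨s, hs, hσs, hs1⟩ := (hev.and hle1).exists
    exact absurd (hσmax (hmemK ht hle (hσ0.trans hσs.le) hs1 (ht'.mem_convexHull_iff.2 hs)))
      (not_le.2 hσs)
  -- `y` is not a vertex, as `x` lies on no line through two points of `P`
  have hwy : ∀ w ∈ t, w ≠ v → 0 < bary t w y := fun w hw hwv => by
    refine lt_of_le_of_ne (ht'.bary_nonneg hyt hw) fun h0 => ?_
    have hye : y ∈ convexHull ℝ (((t.erase v).erase w : Finset Plane) : Set Plane) :=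
      ht'.mem_convexHull_sub ((Finset.erase_subset _ _).trans (Finset.erase_subset _ _))
        (fun u hu => ht'.bary_nonneg hyt hu) fun u hu hu' => by
          simp only [Finset.mem_erase, not_and, ne_eq] at hu'
          by_cases huw : u = w
          · rw [huw, h0]
          · by_cases huv : u = v
            · rw [huv, hvy]
            · exact absurd hu (hu' huw huv)
    have hc1 : ((t.erase v).erase w).card = 1 := by
      rw [Finset.card_erase_of_mem (Finset.mem_erase.2 ⟨hwv, hw⟩), Finset.card_erase_of_mem hv,
        ht'.1]
    obtain ⟨u, hu⟩ := Finset.card_eq_one.1 hc1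
    have hut : u ∈ t := Finset.mem_of_mem_erase (Finset.mem_of_mem_erase
      (hu ▸ Finset.mem_singleton_self u))
    rw [hu, Finset.coe_singleton, convexHull_singleton, Set.mem_singleton_iff] at hye
    have h1σ : (1 - σ) ≠ 0 := (sub_pos.2 hσ1).ne'
    have hxy : x = AffineMap.lineMap y q (-σ / (1 - σ)) := by
      rw [hy, hγ, AffineMap.lineMap_apply_module, AffineMap.lineMap_apply_module]
      match_scalars <;> field_simp <;> ring
    have hyq : y ≠ q := fun h => by
      rw [h, AffineMap.lineMap_same_apply] at hxy
      exact hxg.ne hcard hq hxy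
    refine hxg u (hT.subset t ht hut) q hq (hye ▸ hyq) ?_
    rw [← hye, hxy]
    exact AffineMap.lineMap_mem_affineSpan_pair _ _ _
  -- the next triangle
  obtain ⟨t', ht'T, hfr⟩ : ∃ t' ∈ T, ∃ᶠ s in nhdsWithin σ (Set.Ioi σ),
      γ s ∈ convexHull ℝ (t' : Set Plane) := by
    by_contra! h
    have hall := (Filter.eventually_all_finset T).2 h
    obtain ⟨s, hs, hσs, hs1⟩ := (hall.and hle1).exists
    have hsP : γ s ∈ convexHull ℝ (P : Set Plane) :=
      (convex_convexHull ℝ (P : Set Plane)).lineMap_mem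
        (convexHull_mono (Finset.coe_subset.2 (hT.subset t₀ ht₀)) hx) (subset_convexHull ℝ _ hq)
        ⟨hσ0.trans hσs.le, hs1⟩
    obtain ⟨t', ht'T, hst'⟩ := hT.exists_mem hP hsP
    exact hs t' ht'T hst'
  have htri' := hT.isTriangle t' ht'T
  have hyt' : y ∈ convexHull ℝ (t' : Set Plane) :=
    (IsTriangle.isClosed t').mem_of_frequently_of_tendsto hfr
      (hγc.continuousAt.tendsto.mono_left nhdsWithin_le_nhds)
  obtain ⟨s, hst', hσs, hs1⟩ := (hfr.and_eventually hle1).exists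
  have hnotK : ∀ r ∈ T, lift ψ t q ≤ lift ψ r q → γ s ∉ convexHull ℝ (r : Set Plane) :=
    fun r hr hle' hsr => absurd (hσmax (hmemK hr (hle.trans hle') (hσ0.trans hσs.le) hs1 hsr))
      (not_le.2 hσs)
  have hyi := hT.glue ht ht'T hyt hyt'
  rw [← Finset.coe_inter] at hyi
  have hsub : t.erase v ⊆ t ∩ t' := fun w hw => by
    rw [Finset.mem_erase] at hw
    by_contra hn
    exact (hwy w hw.2 hw.1).ne' (ht'.bary_eq_zero Finset.inter_subset_left hyi hw.2 hn)
  have hcard2 : (t ∩ t').card = 2 := by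
    have h1 := Finset.card_le_card hsub
    rw [Finset.card_erase_of_mem hv, ht'.1] at h1
    have h2 := Finset.card_le_card (Finset.inter_subset_left (s₁ := t) (s₂ := t'))
    rw [ht'.1] at h2
    have h3 : (t ∩ t').card ≠ 3 := fun h3 => by
      have h4 : t ∩ t' = t := Finset.eq_of_subset_of_card_le Finset.inter_subset_left
        (by rw [h3, ht'.1])
      have h5 : t = t' := Finset.eq_of_subset_of_card_le (Finset.inter_eq_left.1 h4)
        (by rw [ht'.1, htri'.1])
      exact hnotK t ht le_rfl (h5 ▸ hst')
    omega
  refine hnotK t' ht'T ?_ hst'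
  rw [htri'.affineMap_apply (lift ψ t), lift_apply ψ t']
  refine Finset.sum_le_sum fun w hw => ?_
  by_cases hwt : w ∈ t
  · rw [ht'.lift_vertex ψ hwt]
  refine mul_le_mul_of_nonneg_left (hloc t ht t' ht'T hcard2 w hw) ?_
  have h1 := hline (bary t' w) s
  rw [htri'.bary_eq_zero Finset.inter_subset_right hyi hw
    (fun h => hwt (Finset.mem_inter.1 h).1), mul_zero, zero_add] at h1
  have h2 := mul_nonneg (sub_pos.2 hσ1).le (htri'.bary_nonneg hst' hw)
  rw [h1] at h2
  exact nonneg_of_mul_nonneg_right h2 (sub_pos.2 hσs)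

/-! ### Orientation and angles in coordinates -/

/-- Twice the signed area of the triangle `p u v`. -/
def cross (p u v : Plane) : ℝ := (u 0 - p 0) * (v 1 - p 1) - (u 1 - p 1) * (v 0 - p 0)

/-- The inner product of `u - p` and `v - p`. -/
def dot (p u v : Plane) : ℝ := (u 0 - p 0) * (v 0 - p 0) + (u 1 - p 1) * (v 1 - p 1)

/-- `cross p u` as an affine function. -/
def crossMap (p u : Plane) : Plane →ᵃ[ℝ] ℝ where
  toFun v := cross p u v
  linear :=
    { toFun := fun v => (u 0 - p 0) * v 1 - (u 1 - p 1) * v 0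
      map_add' := fun v w => by simp; ring
      map_smul' := fun r v => by simp; ring }
  map_vadd' v w := by simp [cross]; ring

@[simp] lemma crossMap_apply (p u v : Plane) : crossMap p u v = cross p u v := rfl

lemma cross_rotate (p u v : Plane) : cross p u v = cross u v p := by
  simp only [cross]; ring

lemma cross_swap (p u v : Plane) : cross p u v = -cross u p v := by
  simp only [cross]; ring

lemma cross_self_left (p v : Plane) : cross p p v = 0 := by simp [cross]

lemma cross_self_right (p u : Plane) : cross p u u = 0 := by simp only [cross]; ring

lemma cross_self_outer (p u : Plane) : cross p u p = 0 := by simp [cross]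

lemma norm_sub_sq_coord (p q : Plane) : ‖p - q‖ ^ 2 = dot q p p := by
  rw [EuclideanSpace.real_norm_sq_eq]
  simp [dot, Fin.sum_univ_two, pow_two]

lemma inner_sub_sub_coord (p u v : Plane) : inner ℝ (u - p) (v - p) = dot p u v := by
  simp [dot, PiLp.inner_apply, Fin.sum_univ_two]
  ring

lemma isTriangle_of_cross_ne_zero [DecidableEq Plane] {a b c : Plane} (h : cross a b c ≠ 0) :
    IsTriangle {a, b, c} := by
  have hab : a ≠ b := by rintro rfl; exact h (cross_self_left _ _)
  have hbc : b ≠ c := by rintro rfl; exact h (cross_self_right _ _)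
  have hac : a ≠ c := by rintro rfl; exact h (cross_self_outer _ _)
  refine ⟨Finset.card_eq_three.2 ⟨a, b, c, hab, hac, hbc, rfl⟩, ?_⟩
  have hnc : ¬ Collinear ℝ {a, b, c} := fun hc => by
    obtain ⟨v, hv⟩ := (collinear_iff_of_mem (p₀ := a) (by simp)).1 hc
    obtain ⟨r, hr⟩ := hv b (by simp)
    obtain ⟨s, hs⟩ := hv c (by simp)
    refine h ?_
    rw [hr, hs]
    simp [cross]
    ring
  have h1 := (affineIndependent_iff_not_collinear_set.2 hnc).range
  have h2 : Set.range ![a, b, c] = (({a, b, c} : Finset Plane) : Set Plane) := by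
    ext x; simp [eq_comm]; tauto
  rw [h2] at h1
  exact h1

lemma IsTriangle.cross_ne_zero [DecidableEq Plane] {a b c : Plane} (h : IsTriangle {a, b, c}) :
    cross a b c ≠ 0 := by
  intro h0
  have h1 : crossMap a b = 0 := h.affineMap_ext fun v hv => by
    simp only [Finset.mem_insert, Finset.mem_singleton] at hv
    rcases hv with rfl | rfl | rfl
    · simp [cross_self_outer]
    · simp [cross_self_right]
    · simpa using h0
  have h2 : ∀ v, cross a b v = 0 := fun v => by rw [← crossMap_apply, h1]; rfl
  have h3 := h2 (a + EuclideanSpace.single 0 1)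
  have h4 := h2 (a + EuclideanSpace.single 1 1)
  simp [cross] at h3 h4
  have hab : a = b := by
    ext i
    fin_cases i
    · simp; linarith
    · simp; linarith
  subst hab
  have := h.1
  have h5 : ({a, a, c} : Finset Plane) = {a, c} := by simp
  rw [h5] at this
  have := Finset.card_le_two (a := a) (b := c)
  omega

/-- Barycentric coordinates are quotients of signed areas. -/
lemma IsTriangle.bary_mul_cross [DecidableEq Plane] {a b c : Plane} (h : IsTriangle {a, b, c})
    (x : Plane) :
    bary {a, b, c} a x * cross a b c = cross b c x := by
  have h0 := h.cross_ne_zero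
  have hab : a ≠ b := by rintro rfl; exact h0 (cross_self_left _ _)
  have hbc : b ≠ c := by rintro rfl; exact h0 (cross_self_right _ _)
  have hac : a ≠ c := by rintro rfl; exact h0 (cross_self_outer _ _)
  rw [← crossMap_apply b c, h.affineMap_apply (crossMap b c) x,
    Finset.sum_insert (by simp [hab, hac]),
    Finset.sum_insert (by simp [hbc]), Finset.sum_singleton]
  simp [cross_self_outer, cross_self_right, cross_rotate a b c]

lemma mem_convexHull_of_cross_pos [DecidableEq Plane] {a b c : Plane} (h : 0 < cross a b c)
    {x : Plane} :
    x ∈ convexHull ℝ (({a, b, c} : Finset Plane) : Set Plane) ↔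
      0 ≤ cross b c x ∧ 0 ≤ cross c a x ∧ 0 ≤ cross a b x := by
  have ht := isTriangle_of_cross_ne_zero h.ne'
  have e1 : ({b, c, a} : Finset Plane) = {a, b, c} := by ext; simp; tauto
  have e2 : ({c, a, b} : Finset Plane) = {a, b, c} := by ext; simp; tauto
  have h1 := ht.bary_mul_cross x
  have h2 := (e1 ▸ ht : IsTriangle {b, c, a}).bary_mul_cross x
  have h3 := (e2 ▸ ht : IsTriangle {c, a, b}).bary_mul_cross x
  rw [e1, ← cross_rotate a b c] at h2
  rw [e2, cross_rotate c a b] at h3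
  rw [ht.mem_convexHull_iff, ← h1, ← h2, ← h3]
  simp only [Finset.mem_insert, Finset.mem_singleton, forall_eq_or_imp, forall_eq,
    mul_nonneg_iff_of_pos_right h]

lemma sin_angle_mul_norm (p u v : Plane) :
    Real.sin (EuclideanGeometry.angle u p v) * (‖u - p‖ * ‖v - p‖) = |cross p u v| := by
  rw [EuclideanGeometry.angle, vsub_eq_sub, vsub_eq_sub,
    InnerProductGeometry.sin_angle_mul_norm_mul_norm, inner_sub_sub_coord,
    inner_sub_sub_coord, inner_sub_sub_coord, ← Real.sqrt_sq_eq_abs]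
  congr 1
  simp only [dot, cross]; ring

lemma cos_angle_mul_norm (p u v : Plane) :
    Real.cos (EuclideanGeometry.angle u p v) * (‖u - p‖ * ‖v - p‖) = dot p u v := by
  rw [EuclideanGeometry.angle, vsub_eq_sub, vsub_eq_sub,
    InnerProductGeometry.cos_angle_mul_norm_mul_norm, inner_sub_sub_coord]

/-- Comparison of angles by their cotangents. -/
lemma angle_lt_angle {p u v p' u' v' : Plane} (h : 0 < cross p u v) (h' : 0 < cross p' u' v')
    (hlt : dot p' u' v' * cross p u v < dot p u v * cross p' u' v') :
    EuclideanGeometry.angle u p v < EuclideanGeometry.angle u' p' v' := by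
  by_contra! hle
  have hs := Real.sin_nonpos_of_nonpos_of_neg_pi_le (sub_nonpos.2 hle) (by
    linarith [EuclideanGeometry.angle_le_pi u p v, EuclideanGeometry.angle_nonneg u' p' v'])
  rw [Real.sin_sub] at hs
  have hN := mul_nonneg (norm_nonneg (u - p)) (norm_nonneg (v - p))
  have hN' := mul_nonneg (norm_nonneg (u' - p')) (norm_nonneg (v' - p'))
  have h1 := mul_nonpos_of_nonpos_of_nonneg hs (mul_nonneg hN hN')
  have e1 := sin_angle_mul_norm p u v
  have e2 := sin_angle_mul_norm p' u' v'
  rw [abs_of_pos h] at e1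
  rw [abs_of_pos h'] at e2
  rw [← e1, ← e2, ← cos_angle_mul_norm, ← cos_angle_mul_norm p u v] at hlt
  nlinarith [h1, hlt]

/-! ### Flipping the diagonal of a convex quadrilateral -/

/-- The quadrilateral `p₁ p₂ p₃ p₄` is convex, with counterclockwise boundary. -/
structure IsConvexQuad (p₁ p₂ p₃ p₄ : Plane) : Prop where
  h₁ : 0 < cross p₁ p₂ p₃
  h₂ : 0 < cross p₂ p₃ p₄
  h₃ : 0 < cross p₃ p₄ p₁
  h₄ : 0 < cross p₄ p₁ p₂

/-- `x` lies in the region bounded by the quadrilateral `p₁ p₂ p₃ p₄`. -/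
def InQuad (p₁ p₂ p₃ p₄ x : Plane) : Prop :=
  0 ≤ cross p₁ p₂ x ∧ 0 ≤ cross p₂ p₃ x ∧ 0 ≤ cross p₃ p₄ x ∧ 0 ≤ cross p₄ p₁ x

lemma IsConvexQuad.rotate {a b c d : Plane} (h : IsConvexQuad a b c d) : IsConvexQuad b c d a :=
  ⟨h.h₂, h.h₃, h.h₄, h.h₁⟩

/-- A diagonal divides a convex quadrilateral into two triangles. -/
lemma IsConvexQuad.mem_half_iff [DecidableEq Plane] {a b c d : Plane} (h : IsConvexQuad a b c d)
    {x : Plane} :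
    x ∈ convexHull ℝ (({a, c, d} : Finset Plane) : Set Plane) ↔
      InQuad a b c d x ∧ 0 ≤ cross a c x := by
  have hpos : 0 < cross a c d := by rw [cross_rotate]; exact h.h₃
  constructor
  · intro hx
    have key : ∀ p q : Plane, 0 ≤ cross p q a → 0 ≤ cross p q c → 0 ≤ cross p q d →
        0 ≤ cross p q x := fun p q h1 h2 h3 =>
      affineMap_nonneg_of_mem_convexHull (crossMap p q) (fun v hv => by
        simp only [Finset.coe_insert, Finset.coe_singleton, Set.mem_insert_iff,
          Set.mem_singleton_iff] at hv
        rcases hv with rfl | rfl | rfl <;> assumption) hx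
    have h1 := (mem_convexHull_of_cross_pos hpos).1 hx
    refine ⟨⟨key _ _ (cross_self_outer _ _).ge h.h₁.le ?_, key _ _ ?_ (cross_self_right _ _).ge
      h.h₂.le, h1.1, h1.2.1⟩, h1.2.2⟩
    · rw [← cross_rotate]; exact h.h₄.le
    · rw [← cross_rotate]; exact h.h₁.le
  · rintro ⟨⟨-, -, h3, h4⟩, h5⟩
    exact (mem_convexHull_of_cross_pos hpos).2 ⟨h3, h4, h5⟩

lemma IsConvexQuad.mem_iff [DecidableEq Plane] {a b c d : Plane} (h : IsConvexQuad a b c d)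
    {x : Plane} :
    InQuad a b c d x ↔ x ∈ convexHull ℝ (({a, c, d} : Finset Plane) : Set Plane) ∨
      x ∈ convexHull ℝ (({c, a, b} : Finset Plane) : Set Plane) := by
  rw [h.mem_half_iff, h.rotate.rotate.mem_half_iff]
  have e : InQuad c d a b x ↔ InQuad a b c d x := by simp only [InQuad]; tauto
  rw [e, cross_swap c a x, ← and_or_left]
  exact ⟨fun hq => ⟨hq, (le_total 0 (cross a c x)).imp id neg_nonneg.2⟩, fun hq => hq.1⟩

/-- The in-circle determinant: for a counterclockwise triangle `abc` it is positive if and only if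
`d` lies inside the circumcircle. -/
def inCircle (a b c d : Plane) : ℝ :=
  cross b c d * dot d a a + cross c a d * dot d b b + cross a b d * dot d c c

/-- Convexity of the squared norm, for a point `v` of the triangle with vertices `0`, `u`, `w` in
which these have the weights `D / B`, `p / B`, `q / B`. -/
lemma convex_of_inCircle {p q B D u₀ u₁ v₀ v₁ w₀ w₁ : ℝ} (hp : 0 ≤ p) (hq : 0 ≤ q) (hD : 0 < D)
    (hB : B = D + p + q) (h0 : B * v₀ = p * u₀ + q * w₀) (h1 : B * v₁ = p * u₁ + q * w₁) :
    B * (v₀ ^ 2 + v₁ ^ 2) ≤ p * (u₀ ^ 2 + u₁ ^ 2) + q * (w₀ ^ 2 + w₁ ^ 2) := by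
  have hB0 : 0 < B := by rw [hB]; positivity
  refine le_of_mul_le_mul_left ?_ hB0
  have e : B * (B * (v₀ ^ 2 + v₁ ^ 2)) = (p * u₀ + q * w₀) ^ 2 + (p * u₁ + q * w₁) ^ 2 := by
    rw [← h0, ← h1]; ring
  have h2 : 0 ≤ D * (p * (u₀ ^ 2 + u₁ ^ 2) + q * (w₀ ^ 2 + w₁ ^ 2)) := by positivity
  have h3 : 0 ≤ p * q * ((u₀ - w₀) ^ 2 + (u₁ - w₁) ^ 2) := by positivity
  rw [e, hB]
  linarith

/-- If `d` lies beyond the edge `ab` of the triangle `abc`, inside its circumcircle, then the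
quadrilateral `a d b c` is convex at `a` and at `b`. If it were not convex at `a`, say, then `a`
would be in the triangle `b c d`, and the squared distance from `d` would violate convexity. -/
lemma cross_pos_of_inCircle {a b c d : Plane} (habc : 0 < cross a b c) (hd : cross a b d < 0)
    (hin : 0 < inCircle a b c d) : 0 < cross b c d ∧ 0 < cross c a d := by
  constructor
  · by_contra! h
    have := convex_of_inCircle (p := -cross b c d) (q := -cross a b d) (B := cross c a d)
      (D := cross a b c) (u₀ := a 0 - d 0) (u₁ := a 1 - d 1) (v₀ := b 0 - d 0) (v₁ := b 1 - d 1)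
      (w₀ := c 0 - d 0) (w₁ := c 1 - d 1) (by linarith) (by linarith) habc
      (by simp only [cross]; ring) (by simp only [cross]; ring) (by simp only [cross]; ring)
    simp only [inCircle, dot] at hin
    linarith
  · by_contra! h
    have := convex_of_inCircle (p := -cross c a d) (q := -cross a b d) (B := cross b c d)
      (D := cross a b c) (u₀ := b 0 - d 0) (u₁ := b 1 - d 1) (v₀ := a 0 - d 0) (v₁ := a 1 - d 1)
      (w₀ := c 0 - d 0) (w₁ := c 1 - d 1) (by linarith) (by linarith) habc
      (by simp only [cross]; ring) (by simp only [cross]; ring) (by simp only [cross]; ring)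
    simp only [inCircle, dot] at hin
    linarith

lemma inCircle_pos_of_lift [DecidableEq Plane] {a b c d : Plane} (habc : 0 < cross a b c)
    (hd : sq d < lift sq {a, b, c} d) : 0 < inCircle a b c d := by
  have ht := isTriangle_of_cross_ne_zero habc.ne'
  have hab : a ≠ b := by rintro rfl; exact habc.ne' (cross_self_left _ _)
  have hbc : b ≠ c := by rintro rfl; exact habc.ne' (cross_self_right _ _)
  have hac : a ≠ c := by rintro rfl; exact habc.ne' (cross_self_outer _ _)
  have e1 : ({b, c, a} : Finset Plane) = {a, b, c} := by ext; simp; tauto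
  have e2 : ({c, a, b} : Finset Plane) = {a, b, c} := by ext; simp; tauto
  have h1 := ht.bary_mul_cross d
  have h2 := (e1 ▸ ht : IsTriangle {b, c, a}).bary_mul_cross d
  have h3 := (e2 ▸ ht : IsTriangle {c, a, b}).bary_mul_cross d
  rw [e1, ← cross_rotate a b c] at h2
  rw [e2, cross_rotate c a b] at h3
  rw [← sub_pos, ht.lift_sq_sub, Finset.sum_insert (by simp [hab, hac]),
    Finset.sum_insert (by simp [hbc]), Finset.sum_singleton] at hd
  simp only [norm_sub_sq_coord] at hd
  have := mul_pos hd habc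
  rw [inCircle, ← h1, ← h2, ← h3]
  linarith

/-- When the diagonal `ab` of a convex quadrilateral `a d b c` fails the in-circle test, each angle
on the side `a` of the other diagonal `cd` exceeds one of the angles at the diagonal `ab`. -/
lemma exists_angle_lt {a b c d : Plane} (h : IsConvexQuad a d b c) (hin : 0 < inCircle a b c d) :
    EuclideanGeometry.angle b a c < EuclideanGeometry.angle d a c ∧
    EuclideanGeometry.angle a b d < EuclideanGeometry.angle a c d ∧
    EuclideanGeometry.angle c b a < EuclideanGeometry.angle c d a := by
  obtain ⟨h1, h2, h3, h4⟩ := h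
  refine ⟨angle_lt_angle ?_ ?_ ?_, angle_lt_angle ?_ h4 ?_, angle_lt_angle h3 ?_ ?_⟩
  · rwa [cross_rotate]
  · rwa [cross_rotate c a d] at h4
  · have hpos : 0 < dot a c c * cross a d b := by
      refine mul_pos ?_ h1
      rw [← norm_sub_sq_coord]
      have : c - a ≠ 0 := sub_ne_zero.2 fun e => by
        rw [e, cross_self_right] at h3; exact lt_irrefl _ h3
      positivity
    simp only [dot, cross] at hpos ⊢
    linarith
  · rwa [cross_rotate]
  · simp only [inCircle, dot, cross] at hin ⊢
    linarith
  · rwa [cross_rotate]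
  · simp only [inCircle, dot, cross] at hin ⊢
    linarith

/-! ### Lexicographic comparison of sorted multisets -/

lemma list_lt_of_count [DecidableEq ℝ] {v : ℝ} : ∀ {l m : List ℝ}, l.Pairwise (· ≤ ·) →
    m.Pairwise (· ≤ ·) → (∀ w < v, l.count w = m.count w) → m.count v < l.count v →
    (∃ b ∈ m, v < b) → l < m
  | [], m, _, _, _, hv, _ => by simp at hv
  | a :: l, [], _, _, _, _, hb => by simp at hb
  | a :: l, b :: m, hl, hm, hw, hv, hb => by
    rw [List.pairwise_cons] at hl hm
    have hav : a ≤ v := by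
      have : v ∈ a :: l := List.count_pos_iff.1 (by omega)
      rcases List.mem_cons.1 this with rfl | h
      · exact le_rfl
      · exact hl.1 v h
    have hab : a ≤ b := by
      by_contra! hlt
      have h1 := hw b (hlt.trans_le hav)
      have h2 : 0 < (a :: l).count b := by rw [h1]; simp
      rcases List.mem_cons.1 (List.count_pos_iff.1 h2) with rfl | h
      · exact lt_irrefl _ hlt
      · exact absurd (hl.1 b h) (not_le.2 hlt)
    rcases hab.lt_or_eq with h | rfl
    · exact List.Lex.rel h
    · refine List.Lex.cons (list_lt_of_count (v := v) hl.2 hm.2 (fun w hwv => ?_) ?_ ?_)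
      · have := hw w hwv
        simp only [List.count_cons] at this
        omega
      · simp only [List.count_cons] at hv
        omega
      · obtain ⟨b', hb', hvb⟩ := hb
        rcases List.mem_cons.1 hb' with rfl | h
        · exact absurd hav (not_le.2 hvb)
        · exact ⟨b', h, hvb⟩

/-- The list of a multiset is smaller than that of another one if, at the smallest value with
different multiplicities, it has the larger multiplicity, and the other one has larger elements
still. -/
lemma sort_lt_sort {A B : Multiset ℝ} {v : ℝ} (h : ∀ w < v, A.count w = B.count w)
    (hv : B.count v < A.count v) (hB : ∃ b ∈ B, v < b) : A.sort (· ≤ ·) < B.sort (· ≤ ·) := by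
  have hc : ∀ (C : Multiset ℝ) (w : ℝ), (C.sort (· ≤ ·)).count w = C.count w := fun C w => by
    rw [← Multiset.coe_count, Multiset.sort_eq]
  refine list_lt_of_count (Multiset.pairwise_sort _ _) (Multiset.pairwise_sort _ _) (v := v)
    (fun w hw => ?_) ?_ ?_
  · rw [hc, hc, h w hw]
  · rwa [hc, hc]
  · simpa using hB

/-- Replacing elements of a multiset by elements that are all larger than some replaced one
increases its sorted list. -/
lemma sort_add_lt_of_exists_lt {M N : Multiset ℝ} (hN : N ≠ 0)
    (h : ∀ n ∈ N, ∃ m ∈ M, m < n) (R : Multiset ℝ) :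
    (M + R).sort (· ≤ ·) < (N + R).sort (· ≤ ·) := by
  obtain ⟨n₀, hn₀⟩ := Multiset.exists_mem_of_ne_zero hN
  obtain ⟨m₀, hm₀, -⟩ := h n₀ hn₀
  obtain ⟨v, hv, hmin⟩ := Finset.exists_min_image M.toFinset id ⟨m₀, by simpa using hm₀⟩
  simp only [Multiset.mem_toFinset, id] at hv hmin
  have hvn : ∀ n ∈ N, v < n := fun n hn => by
    obtain ⟨m, hm, hmn⟩ := h n hn
    exact (hmin m hm).trans_lt hmn
  refine sort_lt_sort (v := v) (fun w hw => ?_) ?_ ⟨n₀, by simp [hn₀], hvn n₀ hn₀⟩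
  · rw [Multiset.count_add, Multiset.count_add,
      Multiset.count_eq_zero_of_notMem fun hwM => absurd (hmin w hwM) (not_le.2 hw),
      Multiset.count_eq_zero_of_notMem fun hwN => lt_asymm hw (hvn w hwN)]
  · rw [Multiset.count_add, Multiset.count_add,
      Multiset.count_eq_zero_of_notMem fun hvN => lt_irrefl _ (hvn v hvN)]
    have := Multiset.count_pos.2 hv
    omega

/-- The lexicographic comparison of two multisets, neither of which contains the other, does not
change when the same elements are added to both. -/
lemma sort_add_lt_or {M N : Multiset ℝ} (h1 : ¬ M ≤ N) (h2 : ¬ N ≤ M) :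
    (∀ R : Multiset ℝ, (M + R).sort (· ≤ ·) < (N + R).sort (· ≤ ·)) ∨
      ∀ R : Multiset ℝ, (N + R).sort (· ≤ ·) < (M + R).sort (· ≤ ·) := by
  have hex : ((M.toFinset ∪ N.toFinset).filter fun w => M.count w ≠ N.count w).Nonempty := by
    by_contra hne
    rw [Finset.not_nonempty_iff_eq_empty, Finset.filter_eq_empty_iff] at hne
    refine h1 (le_of_eq (Multiset.ext.2 fun w => ?_))
    by_cases hw : w ∈ M.toFinset ∪ N.toFinset
    · exact not_not.1 (hne hw)
    · simp only [Finset.mem_union, Multiset.mem_toFinset, not_or] at hw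
      rw [Multiset.count_eq_zero_of_notMem hw.1, Multiset.count_eq_zero_of_notMem hw.2]
  obtain ⟨v, hv, hmin⟩ := Finset.exists_min_image _ id hex
  have heq : ∀ w < v, M.count w = N.count w := fun w hw => by
    by_contra hne
    have hmem : w ∈ M.toFinset ∪ N.toFinset := by
      by_contra hn
      simp only [Finset.mem_union, Multiset.mem_toFinset, not_or] at hn
      rw [Multiset.count_eq_zero_of_notMem hn.1, Multiset.count_eq_zero_of_notMem hn.2] at hne
      exact hne rfl
    exact absurd (hmin w (Finset.mem_filter.2 ⟨hmem, hne⟩)) (not_le.2 hw)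
  have key : ∀ A B : Multiset ℝ, ¬ B ≤ A → (∀ w < v, A.count w = B.count w) →
      B.count v < A.count v → ∀ R : Multiset ℝ,
      (A + R).sort (· ≤ ·) < (B + R).sort (· ≤ ·) := fun A B hBA hAB hlt R => by
    obtain ⟨b, hb, hvb⟩ : ∃ b ∈ B, v < b := by
      by_contra! hle
      refine hBA (Multiset.le_iff_count.2 fun w => ?_)
      rcases lt_trichotomy w v with hw | rfl | hw
      · exact (hAB w hw).ge
      · exact hlt.le
      · rw [Multiset.count_eq_zero_of_notMem fun h => absurd (hle w h) (not_le.2 hw)]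
        exact Nat.zero_le _
    refine sort_lt_sort (v := v) (fun w hw => ?_) ?_ ⟨b, by simp [hb], hvb⟩
    · rw [Multiset.count_add, Multiset.count_add, hAB w hw]
    · rw [Multiset.count_add, Multiset.count_add]
      omega
  rcases lt_or_gt_of_ne (Finset.mem_filter.1 hv).2 with h | h
  · exact Or.inr (key N M h1 (fun w hw => (heq w hw).symm) h)
  · exact Or.inl (key M N h2 heq h)

/-! ### The angles of a tiling -/

/-- The angles of a set of triangles, with multiplicity. -/
def tilingAngles (T : Finset (Finset Plane)) : Multiset ℝ := T.val.bind triangleAngles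

lemma mem_triangleAngles {θ : ℝ} : θ ∈ triangleAngles t ↔ ∃ v ∈ t, ∃ a ∈ t, ∃ b ∈ t,
    a ≠ v ∧ b ≠ v ∧ a ≠ b ∧ EuclideanGeometry.angle a v b = θ := by
  classical
  simp only [triangleAngles, Multiset.mem_bind, Multiset.mem_map, Finset.mem_val,
    Finset.mem_filter]
  refine exists_congr fun v => and_congr_right fun hv => ?_
  constructor
  · rintro ⟨e, ⟨he, hd⟩, rfl⟩
    induction e using Sym2.ind with
    | _ a b =>
      rw [Finset.mk_mem_sym2_iff, Finset.mem_erase, Finset.mem_erase] at he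
      exact ⟨a, he.1.2, b, he.2.2, he.1.1, he.2.1, hd, rfl⟩
  · rintro ⟨a, ha, b, hb, hav, hbv, hab, rfl⟩
    refine ⟨s(a, b), ⟨?_, hab⟩, rfl⟩
    rw [Finset.mk_mem_sym2_iff, Finset.mem_erase, Finset.mem_erase]
    exact ⟨⟨hav, ha⟩, hbv, hb⟩

lemma mem_tilingAngles {θ : ℝ} : θ ∈ tilingAngles T ↔ ∃ t ∈ T, θ ∈ triangleAngles t := by
  simp [tilingAngles, Multiset.mem_bind]

lemma triangleAngles_triple [DecidableEq Plane] {a b c : Plane} {θ : ℝ}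
    (hθ : θ ∈ triangleAngles {a, b, c}) : θ = EuclideanGeometry.angle b a c ∨
      θ = EuclideanGeometry.angle a b c ∨ θ = EuclideanGeometry.angle a c b := by
  obtain ⟨v, hv, x, hx, y, hy, hxv, hyv, hxy, rfl⟩ := mem_triangleAngles.1 hθ
  simp only [Finset.mem_insert, Finset.mem_singleton] at hv hx hy
  rcases hv with rfl | rfl | rfl <;> rcases hx with rfl | rfl | rfl <;>
    rcases hy with rfl | rfl | rfl <;>
    simp_all [EuclideanGeometry.angle_comm]

lemma tilingAngles_sdiff_union [DecidableEq (Finset Plane)] {X Y : Finset (Finset Plane)}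
    (h : Disjoint (T \ X) Y) :
    tilingAngles ((T \ X) ∪ Y) = tilingAngles Y + tilingAngles (T \ X) := by
  rw [← Finset.disjUnion_eq_union _ _ h, tilingAngles, Finset.disjUnion_val, Multiset.add_bind,
    add_comm]
  rfl

lemma tilingAngles_eq_add [DecidableEq (Finset Plane)] {X : Finset (Finset Plane)} (h : X ⊆ T) :
    tilingAngles T = tilingAngles X + tilingAngles (T \ X) := by
  rw [← tilingAngles_sdiff_union Finset.sdiff_disjoint, Finset.sdiff_union_of_subset h]

lemma IsTriangle.exists_mem_triangleAngles (ht : IsTriangle t) : ∃ θ, θ ∈ triangleAngles t := by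
  obtain ⟨a, b, c, hab, hac, hbc, rfl⟩ := Finset.card_eq_three.1 ht.1
  exact ⟨_, mem_triangleAngles.2 ⟨a, by simp, b, by simp, c, by simp, hab.symm, hac.symm, hbc, rfl⟩⟩

/-! ### Tilings with a maximal list of angles are Delaunay -/

/-- The triangles on both sides of an edge lie on different sides. -/
lemma IsTiling.cross_neg [DecidableEq Plane] (hT : IsTiling P T) {a b c d : Plane}
    (ht : {a, b, c} ∈ T) (ht' : {a, b, d} ∈ T) (hcd : c ≠ d) (habc : 0 < cross a b c) :
    cross a b d < 0 := by
  by_contra! hd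
  replace hd := lt_of_le_of_ne hd (hT.isTriangle _ ht').cross_ne_zero.symm
  set m := midpoint ℝ a b with hm
  have hcm : ∀ p q : Plane, cross p q m = (cross p q a + cross p q b) / 2 := fun p q => by
    rw [hm, ← crossMap_apply, midpoint, affineMap_lineMap, crossMap_apply, crossMap_apply]
    norm_num; ring
  have hl : ∀ (p q : Plane) (ε : ℝ), cross p q (AffineMap.lineMap m d ε) =
      (1 - ε) * cross p q m + ε * cross p q d := fun p q ε => affineMap_lineMap (crossMap p q) m d ε
  have hcont : ∀ p q : Plane, Continuous fun ε : ℝ => cross p q (AffineMap.lineMap m d ε) :=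
    fun p q => by simp only [hl]; fun_prop
  have hev : ∀ p q : Plane, 0 < cross p q m → ∀ᶠ ε : ℝ in nhdsWithin 0 (Set.Ioi 0),
      0 ≤ cross p q (AffineMap.lineMap m d ε) := fun p q hpq =>
    nhdsWithin_le_nhds (((hcont p q).continuousAt.eventually (lt_mem_nhds
      (by simpa using hpq))).mono fun _ h => le_of_lt h)
  have h1 : 0 < cross b c m := by
    rw [hcm, cross_self_outer, ← cross_rotate]; linarith
  have h2 : 0 < cross c a m := by
    rw [hcm, cross_self_right, cross_rotate]; linarith
  obtain ⟨ε, ⟨⟨h3, h4⟩, h5⟩, h6⟩ := (((hev _ _ h1).and (hev _ _ h2)).and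
    (self_mem_nhdsWithin)).and (nhdsWithin_le_nhds (Iio_mem_nhds (zero_lt_one' ℝ))) |>.exists
  replace h5 : 0 < ε := h5
  replace h6 : ε < 1 := h6
  have hm0 : cross a b m = 0 := by rw [hcm, cross_self_outer, cross_self_right]; norm_num
  have h7 : 0 < cross a b (AffineMap.lineMap m d ε) := by
    rw [hl, hm0, mul_zero, zero_add]; exact mul_pos h5 hd
  have hmem := (mem_convexHull_of_cross_pos habc).2 ⟨h3, h4, h7.le⟩
  have hconv := convex_convexHull ℝ (({a, b, d} : Finset Plane) : Set Plane)
  have hmem' := hconv.lineMap_mem (hconv.lineMap_mem (subset_convexHull ℝ _ (by simp : a ∈ _))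
    (subset_convexHull ℝ _ (by simp : b ∈ _)) (t := (⅟2 : ℝ)) ⟨by norm_num, by norm_num⟩)
    (subset_convexHull ℝ _ (by simp : d ∈ _)) ⟨h5.le, h6.le⟩
  have hglue := hT.glue ht ht' hmem hmem'
  have h8 : cross a b (AffineMap.lineMap m d ε) = 0 := by
    refine affineMap_eq_zero_of_mem_convexHull (crossMap a b) (fun v hv => ?_) hglue
    simp only [Finset.coe_insert, Finset.coe_singleton, Set.mem_inter_iff, Set.mem_insert_iff,
      Set.mem_singleton_iff] at hv
    obtain ⟨h9, h10⟩ := hv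
    rcases h9 with rfl | rfl | rfl
    · exact cross_self_outer _ _
    · exact cross_self_right _ _
    · rcases h10 with rfl | rfl | h10
      · exact cross_self_outer _ _
      · exact cross_self_right _ _
      · exact absurd h10 hcd
  exact h7.ne' h8

/-- A pair of adjacent triangles violating the Delaunay condition can be flipped, and each new angle
exceeds some old one. -/
lemma IsTiling.exists_flip [DecidableEq Plane] [DecidableEq (Finset Plane)] (hT : IsTiling P T)
    {a b c d : Plane} (ht : {a, b, c} ∈ T) (ht' : {a, b, d} ∈ T) (hcd : c ≠ d)
    (habc : 0 < cross a b c) (hd : sq d < lift sq {a, b, c} d) :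
    ∃ X ⊆ T, ∃ Y, IsTiling P ((T \ X) ∪ Y) ∧ Disjoint (T \ X) Y ∧ tilingAngles Y ≠ 0 ∧
      ∀ θ ∈ tilingAngles Y, ∃ θ' ∈ tilingAngles X, θ' < θ := by
  have hin := inCircle_pos_of_lift habc hd
  have habd := hT.cross_neg ht ht' hcd habc
  obtain ⟨hbcd, hcad⟩ := cross_pos_of_inCircle habc habd hin
  have hq : IsConvexQuad a d b c := ⟨by simp only [cross] at *; linarith,
    by rwa [cross_rotate], by rwa [← cross_rotate], hcad⟩
  have hin' : 0 < inCircle b a d c := by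
    simp only [inCircle, cross, dot] at hin ⊢; linarith
  have hdca : 0 < cross d c a := by rwa [cross_rotate]
  have hcdb : 0 < cross c d b := by rw [cross_rotate]; exact hq.h₂
  have e1 : ({b, a, d} : Finset Plane) = {a, b, d} := by ext; simp; tauto
  have e2 : ({d, c, a} : Finset Plane) = {c, a, d} := by ext; simp; tauto
  have hdiag : ∀ x, (x ∈ convexHull ℝ (({a, b, c} : Finset Plane) : Set Plane) ∨
      x ∈ convexHull ℝ (({a, b, d} : Finset Plane) : Set Plane)) ↔
      (x ∈ convexHull ℝ (({d, c, a} : Finset Plane) : Set Plane) ∨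
      x ∈ convexHull ℝ (({c, d, b} : Finset Plane) : Set Plane)) := fun x => by
    have h1 := hq.mem_iff (x := x)
    have h2 := hq.rotate.mem_iff (x := x)
    have e : InQuad d b c a x ↔ InQuad a d b c x := by simp only [InQuad]; tauto
    rw [e1] at h1
    rw [← h1, ← h2, e]
  have hnd := isTriangle_of_cross_ne_zero hdca.ne'
  have hnd' := isTriangle_of_cross_ne_zero hcdb.ne'
  have hsub := hT.subset _ ht
  have hsub' := hT.subset _ ht'
  have ha : a ∈ P := hsub (by simp)
  have hb : b ∈ P := hsub (by simp)
  have hc : c ∈ P := hsub (by simp)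
  have hdP : d ∈ P := hsub' (by simp)
  have hYP : ∀ s ∈ ({{d, c, a}, {c, d, b}} : Finset (Finset Plane)), s ⊆ P := fun s hs => by
    simp only [Finset.mem_insert, Finset.mem_singleton] at hs
    rcases hs with rfl | rfl <;> simp [Finset.insert_subset_iff, *]
  have hYtri : ∀ s ∈ ({{d, c, a}, {c, d, b}} : Finset (Finset Plane)), IsTriangle s :=
    fun s hs => by
      simp only [Finset.mem_insert, Finset.mem_singleton] at hs
      rcases hs with rfl | rfl <;> assumption
  have hXY : ∀ x, Generic P x →
      ((∃ s ∈ ({{a, b, c}, {a, b, d}} : Finset (Finset Plane)),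
        x ∈ convexHull ℝ (s : Set Plane)) ↔
      ∃ s ∈ ({{d, c, a}, {c, d, b}} : Finset (Finset Plane)),
        x ∈ convexHull ℝ (s : Set Plane)) := fun x _ => by
    simpa only [Finset.mem_insert, Finset.mem_singleton, exists_eq_or_imp, exists_eq_left]
      using hdiag x
  have hXT : ({{a, b, c}, {a, b, d}} : Finset (Finset Plane)) ⊆ T := by
    simp [Finset.insert_subset_iff, ht, ht']
  have hfour : ∀ p ∈ P, (p ∈ convexHull ℝ (({d, c, a} : Finset Plane) : Set Plane) ∨
      p ∈ convexHull ℝ (({c, d, b} : Finset Plane) : Set Plane)) →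
      p = a ∨ p = b ∨ p = c ∨ p = d := fun p hp hpm => by
    rcases (hdiag p).2 hpm with h | h
    · have := hT.empty _ ht p hp h
      simp only [Finset.mem_insert, Finset.mem_singleton] at this
      tauto
    · have := hT.empty _ ht' p hp h
      simp only [Finset.mem_insert, Finset.mem_singleton] at this
      tauto
  have hdisj : ∀ x, Generic P x → x ∈ convexHull ℝ (({d, c, a} : Finset Plane) : Set Plane) →
      x ∈ convexHull ℝ (({c, d, b} : Finset Plane) : Set Plane) → False := fun x hx h h' => by
    have h1 := ((mem_convexHull_of_cross_pos hcdb).1 h').2.2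
    have h3 := hx.bary_pos hnd (hYP _ (by simp)) h (v := a) (by simp)
    have e3 : ({d, c, a} : Finset Plane) = {a, d, c} := by ext; simp; tauto
    rw [e3] at h3 hnd
    have h4 := hnd.bary_mul_cross x
    have h5 := mul_pos h3 (by rwa [cross_rotate] : 0 < cross a d c)
    rw [h4, cross_swap] at h5
    linarith
  refine ⟨{{a, b, c}, {a, b, d}}, hXT, {{d, c, a}, {c, d, b}}, hT.replace hXT hYP hYtri ?_ ?_ hXY,
    hT.disjoint_of_cover hXT hYtri hXY, ?_, ?_⟩
  · intro s hs p hp hps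
    simp only [Finset.mem_insert, Finset.mem_singleton] at hs
    rcases hs with rfl | rfl
    · rcases hfour p hp (Or.inl hps) with rfl | rfl | rfl | rfl <;> try simp
      have := ((mem_convexHull_of_cross_pos hdca).1 hps).2.2
      rw [cross_swap] at this
      linarith
    · rcases hfour p hp (Or.inr hps) with rfl | rfl | rfl | rfl <;> try simp
      have := ((mem_convexHull_of_cross_pos hcdb).1 hps).2.2
      rw [cross_swap] at this
      linarith
  · intro x hx s hs r hr hxs hxr
    simp only [Finset.mem_insert, Finset.mem_singleton] at hs hr
    rcases hs with rfl | rfl <;> rcases hr with rfl | rfl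
    · rfl
    · exact (hdisj x hx hxs hxr).elim
    · exact (hdisj x hx hxr hxs).elim
    · rfl
  · obtain ⟨θ, hθ⟩ := hnd.exists_mem_triangleAngles
    intro h0
    have : θ ∈ tilingAngles {{d, c, a}, {c, d, b}} := mem_tilingAngles.2 ⟨_, by simp, hθ⟩
    rw [h0] at this
    simp at this
  · have hab : a ≠ b := by rintro rfl; exact habc.ne' (cross_self_left _ _)
    have hbc : b ≠ c := by rintro rfl; exact habc.ne' (cross_self_right _ _)
    have hac : a ≠ c := by rintro rfl; exact habc.ne' (cross_self_outer _ _)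
    have had : a ≠ d := by rintro rfl; exact habd.ne (cross_self_outer _ _)
    have hbd : b ≠ d := by rintro rfl; exact habd.ne (cross_self_right _ _)
    have hold : ∀ v x y, v ∈ ({a, b, c} : Finset Plane) → x ∈ ({a, b, c} : Finset Plane) →
        y ∈ ({a, b, c} : Finset Plane) → x ≠ v → y ≠ v → x ≠ y →
        EuclideanGeometry.angle x v y ∈ tilingAngles {{a, b, c}, {a, b, d}} :=
      fun v x y hv hx hy h1 h2 h3 => mem_tilingAngles.2 ⟨{a, b, c}, by simp,
        mem_triangleAngles.2 ⟨v, hv, x, hx, y, hy, h1, h2, h3, rfl⟩⟩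
    have hold' : ∀ v x y, v ∈ ({a, b, d} : Finset Plane) → x ∈ ({a, b, d} : Finset Plane) →
        y ∈ ({a, b, d} : Finset Plane) → x ≠ v → y ≠ v → x ≠ y →
        EuclideanGeometry.angle x v y ∈ tilingAngles {{a, b, c}, {a, b, d}} :=
      fun v x y hv hx hy h1 h2 h3 => mem_tilingAngles.2 ⟨{a, b, d}, by simp,
        mem_triangleAngles.2 ⟨v, hv, x, hx, y, hy, h1, h2, h3, rfl⟩⟩
    obtain ⟨l1, l2, l3⟩ := exists_angle_lt hq hin
    obtain ⟨m1, m2, m3⟩ := exists_angle_lt hq.rotate.rotate hin'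
    have o1 := hold a b c (by simp) (by simp) (by simp) hab.symm hac.symm hbc
    have o2 := hold b c a (by simp) (by simp) (by simp) hbc.symm hab hac.symm
    have o3 := hold' b a d (by simp) (by simp) (by simp) hab hbd.symm had
    have o4 := hold' a d b (by simp) (by simp) (by simp) had.symm hab.symm hbd.symm
    intro θ hθ
    obtain ⟨s, hs, hθs⟩ := mem_tilingAngles.1 hθ
    simp only [Finset.mem_insert, Finset.mem_singleton] at hs
    rcases hs with rfl | rfl <;> rcases triangleAngles_triple hθs with rfl | rfl | rfl
    · exact ⟨_, o2, l3⟩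
    · rw [EuclideanGeometry.angle_comm]
      exact ⟨_, o3, l2⟩
    · exact ⟨_, o1, l1⟩
    · exact ⟨_, o4, m3⟩
    · rw [EuclideanGeometry.angle_comm]
      exact ⟨_, o1, m2⟩
    · exact ⟨_, o3, m1⟩

/-- The tiling `T` has the lexicographically largest sorted list of angles. -/
def IsMaxTiling (P : Finset Plane) (T : Finset (Finset Plane)) : Prop :=
  IsTiling P T ∧ ∀ S, IsTiling P S →
    (tilingAngles S).sort (· ≤ ·) ≤ (tilingAngles T).sort (· ≤ ·)

lemma IsMaxTiling.not_lt_replace [DecidableEq (Finset Plane)] (hT : IsMaxTiling P T)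
    {X Y : Finset (Finset Plane)} (hX : X ⊆ T) (h : IsTiling P ((T \ X) ∪ Y))
    (hd : Disjoint (T \ X) Y) :
    ¬ ∀ R : Multiset ℝ,
      (tilingAngles X + R).sort (· ≤ ·) < (tilingAngles Y + R).sort (· ≤ ·) := fun hlt => by
  have h1 := hT.2 _ h
  rw [tilingAngles_sdiff_union hd, tilingAngles_eq_add hX] at h1
  exact absurd h1 (not_le.2 (hlt _))

lemma IsMaxTiling.local [DecidableEq Plane] (hT : IsMaxTiling P T) :
    ∀ t ∈ T, ∀ t' ∈ T, (t ∩ t').card = 2 → ∀ d ∈ t', lift sq t d ≤ sq d := by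
  classical
  intro t ht t' ht' hcard d hd
  by_contra! hlt
  have htri := hT.1.isTriangle t ht
  have htri' := hT.1.isTriangle t' ht'
  have hdt : d ∉ t := fun h => by rw [htri.lift_vertex sq h] at hlt; exact lt_irrefl _ hlt
  have key : ∀ a b c : Plane, t = {a, b, c} → t' = {a, b, d} → 0 < cross a b c → False := by
    rintro a b c rfl rfl hpos
    have hcd : c ≠ d := fun h => hdt (by simp [h])
    obtain ⟨X, hX, Y, hXY, hdisj, hne, hang⟩ := hT.1.exists_flip ht ht' hcd hpos hlt
    exact hT.not_lt_replace hX hXY hdisj (sort_add_lt_of_exists_lt hne hang)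
  obtain ⟨a, b, hab, hi⟩ := Finset.card_eq_two.1 hcard
  have hsub : {a, b} ⊆ t := hi ▸ Finset.inter_subset_left
  have hsub' : {a, b} ⊆ t' := hi ▸ Finset.inter_subset_right
  obtain ⟨c, hc, hcab⟩ := Finset.exists_mem_notMem_of_card_lt_card (s := {a, b}) (t := t) (by
    rw [htri.1, Finset.card_pair hab]; norm_num)
  have hdab : d ∉ ({a, b} : Finset Plane) := fun h => hdt (hsub h)
  have full : ∀ (r : Finset Plane) (e : Plane), IsTriangle r → {a, b} ⊆ r → e ∈ r →
      e ∉ ({a, b} : Finset Plane) → r = {a, b, e} := fun r e hr hs he hne => by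
    have h1 : insert e {a, b} = r := Finset.eq_of_subset_of_card_le (Finset.insert_subset he hs) (by
      rw [hr.1, Finset.card_insert_of_notMem hne, Finset.card_pair hab])
    rw [← h1]
    ext; simp; tauto
  have h1 := full t c htri hsub hc hcab
  have h2 := full t' d htri' hsub' hd hdab
  rcases lt_or_gt_of_ne (h1 ▸ htri : IsTriangle {a, b, c}).cross_ne_zero with h | h
  · refine key b a c ?_ ?_ (by rw [cross_swap]; linarith)
    · rw [h1]; ext; simp; tauto
    · rw [h2]; ext; simp; tauto
  · exact key a b c h1 h2 h

lemma IsMaxTiling.delaunay (hP : affineSpan ℝ (P : Set Plane) = ⊤) (hT : IsMaxTiling P T) :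
    ∀ t ∈ T, ∀ q ∈ P, lift sq t q ≤ sq q := by
  classical
  exact fun t ht q hq => hT.1.lift_le_of_local hP hT.local t ht q hq

/-! ### Uniqueness of the optimal tiling -/

/-- The law of sines on a fixed circle, which is cut out of the paraboloid by the plane `H`. The
constant `κ` is the square of the radius. -/
lemma exists_dist_sq_eq (H : Plane →ᵃ[ℝ] ℝ) : ∃ κ : ℝ, ∀ a v b : Plane, H a = sq a → H v = sq v →
    H b = sq b → a ≠ v → b ≠ v →
    dist a b ^ 2 = 4 * κ * Real.sin (EuclideanGeometry.angle a v b) ^ 2 := by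
  obtain ⟨o₀, o₁, k, hH⟩ : ∃ o₀ o₁ k : ℝ, ∀ p : Plane, H p = 2 * o₀ * p 0 + 2 * o₁ * p 1 + k := by
    refine ⟨H.linear (EuclideanSpace.single 0 1) / 2, H.linear (EuclideanSpace.single 1 1) / 2, H 0,
      fun p => ?_⟩
    have hp : p = p 0 • EuclideanSpace.single 0 (1 : ℝ) +
        p 1 • EuclideanSpace.single 1 (1 : ℝ) := by
      ext i; fin_cases i <;> simp
    have h1 := congrFun H.decomp p
    simp only [Pi.add_apply] at h1
    rw [h1]
    conv_lhs => rw [hp]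
    simp only [map_add, map_smul, smul_eq_mul]
    ring
  refine ⟨o₀ ^ 2 + o₁ ^ 2 + k, fun a v b ha hv hb hav hbv => ?_⟩
  have hsq : ∀ p : Plane, sq p = p 0 ^ 2 + p 1 ^ 2 := fun p => by
    rw [sq, EuclideanSpace.real_norm_sq_eq, Fin.sum_univ_two]
  rw [hH, hsq] at ha hv hb
  have hna : ‖a - v‖ ^ 2 ≠ 0 := pow_ne_zero 2 (norm_ne_zero_iff.2 (sub_ne_zero.2 hav))
  have hnb : ‖b - v‖ ^ 2 ≠ 0 := pow_ne_zero 2 (norm_ne_zero_iff.2 (sub_ne_zero.2 hbv))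
  have hs : Real.sin (EuclideanGeometry.angle a v b) ^ 2 * (‖a - v‖ ^ 2 * ‖b - v‖ ^ 2) =
      cross v a b ^ 2 := by
    rw [← sq_abs (cross v a b), ← sin_angle_mul_norm]; ring
  refine mul_right_cancel₀ (mul_ne_zero hna hnb) ?_
  rw [mul_assoc (4 * _), hs, dist_eq_norm, norm_sub_sq_coord, norm_sub_sq_coord, norm_sub_sq_coord]
  -- the vectors `a - v`, `b - v` and the vector from `v` to the centre of the circle
  have hu : dot v a a = 2 * ((a 0 - v 0) * (o₀ - v 0) + (a 1 - v 1) * (o₁ - v 1)) := by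
    simp only [dot]; linarith
  have hw : dot v b b = 2 * ((b 0 - v 0) * (o₀ - v 0) + (b 1 - v 1) * (o₁ - v 1)) := by
    simp only [dot]; linarith
  have hκ : o₀ ^ 2 + o₁ ^ 2 + k = (o₀ - v 0) ^ 2 + (o₁ - v 1) ^ 2 := by linarith
  have key : 4 * ((o₀ - v 0) ^ 2 + (o₁ - v 1) ^ 2) * cross v a b ^ 2 =
      (dot v a a * (b 0 - v 0) - dot v b b * (a 0 - v 0)) ^ 2 +
      (dot v a a * (b 1 - v 1) - dot v b b * (a 1 - v 1)) ^ 2 := by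
    rw [hu, hw]; simp only [cross]; ring
  rw [hκ, key]
  simp only [dot]; ring

/-- The triangles of `T` whose lifted vertices span the plane `H`, i.e. those inscribed in one
circle. -/
def trianglesOver [DecidableEq (Plane →ᵃ[ℝ] ℝ)] (T : Finset (Finset Plane)) (H : Plane →ᵃ[ℝ] ℝ) :
    Finset (Finset Plane) := T.filter fun t => lift sq t = H

/-- For two Delaunay tilings, the triangles inscribed in one circle cover the same region. -/
lemma trianglesOver_cover [DecidableEq (Plane →ᵃ[ℝ] ℝ)] (hT : IsTiling P T) (hS : IsTiling P S)
    (hTd : ∀ t ∈ T, ∀ q ∈ P, lift sq t q ≤ sq q) (hSd : ∀ t ∈ S, ∀ q ∈ P, lift sq t q ≤ sq q)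
    (H : Plane →ᵃ[ℝ] ℝ) {x : Plane} (hx : Generic P x)
    (h : ∃ t ∈ trianglesOver T H, x ∈ convexHull ℝ (t : Set Plane)) :
    ∃ t ∈ trianglesOver S H, x ∈ convexHull ℝ (t : Set Plane) := by
  obtain ⟨t, ht, hxt⟩ := h
  rw [trianglesOver, Finset.mem_filter] at ht
  obtain ⟨s, hs, hxs⟩ := hS.cover x hx
    (convexHull_mono (Finset.coe_subset.2 (hT.subset t ht.1)) hxt)
  refine ⟨s, Finset.mem_filter.2 ⟨hs, ?_⟩, hxs⟩
  rw [← ht.2]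
  exact lift_eq_of_generic (hS.isTriangle s hs) (hT.isTriangle t ht.1) (hS.subset s hs)
    (hT.subset t ht.1) (hSd s hs) (hTd t ht.1) hx hxs hxt

/-- If the angles of the triangles of `T` inscribed in a circle all occur among those of `S`, then
these triangles belong to `S`: an angle determines the length of the opposite chord, and the length
determines the edge. -/
lemma trianglesOver_subset [DecidableEq (Plane →ᵃ[ℝ] ℝ)] (hD : DistinctPairwiseDistances P)
    (hT : IsTiling P T) (hS : IsTiling P S) (H : Plane →ᵃ[ℝ] ℝ)
    (hle : tilingAngles (trianglesOver T H) ≤ tilingAngles (trianglesOver S H)) :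
    trianglesOver T H ⊆ trianglesOver S H := by
  classical
  obtain ⟨κ, hκ⟩ := exists_dist_sq_eq H
  intro t ht
  have htT := Finset.mem_filter.1 ht
  have ht' := hT.isTriangle t htT.1
  have hval : ∀ (U : Finset (Finset Plane)), IsTiling P U → ∀ s ∈ trianglesOver U H, ∀ p ∈ s,
      H p = sq p := fun U hU s hs p hp => by
    rw [← (Finset.mem_filter.1 hs).2,
      (hU.isTriangle s (Finset.mem_filter.1 hs).1).lift_vertex sq hp]
  refine Finset.mem_filter.2 ⟨hS.mem_of_edges (hT.subset t htT.1) ht' (hT.empty t htT.1) ?_, htT.2⟩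
  intro v hv
  obtain ⟨a, b, hab, he⟩ := Finset.card_eq_two.1 (by
    rw [Finset.card_erase_of_mem hv, ht'.1] : (t.erase v).card = 2)
  have ha : a ∈ t.erase v := by rw [he]; simp
  have hb : b ∈ t.erase v := by rw [he]; simp
  rw [Finset.mem_erase] at ha hb
  have hmem : EuclideanGeometry.angle a v b ∈ tilingAngles (trianglesOver T H) :=
    mem_tilingAngles.2 ⟨t, ht, mem_triangleAngles.2 ⟨v, hv, a, ha.2, b, hb.2, ha.1, hb.1, hab, rfl⟩⟩
  obtain ⟨s, hs, hsθ⟩ := mem_tilingAngles.1 (Multiset.mem_of_le hle hmem)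
  obtain ⟨v', hv', a', ha', b', hb', hav', hbv', hab', hang⟩ := mem_triangleAngles.1 hsθ
  have hsS := (Finset.mem_filter.1 hs).1
  have h1 := hκ a v b (hval T hT t ht a ha.2) (hval T hT t ht v hv) (hval T hT t ht b hb.2)
    ha.1 hb.1
  have h2 := hκ a' v' b' (hval S hS s hs a' ha') (hval S hS s hs v' hv') (hval S hS s hs b' hb')
    hav' hbv'
  rw [hang, ← h1] at h2
  have h3 : dist a b = dist a' b' := ((sq_eq_sq₀ dist_nonneg dist_nonneg).1 h2).symm
  have h4 := hD a (hT.subset t htT.1 ha.2) b (hT.subset t htT.1 hb.2) a' (hS.subset s hsS ha')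
    b' (hS.subset s hsS hb') hab hab' h3
  refine ⟨s, hsS, ?_⟩
  rw [he, Finset.insert_subset_iff, Finset.singleton_subset_iff]
  rcases Sym2.eq_iff.1 h4 with ⟨rfl, rfl⟩ | ⟨rfl, rfl⟩
  · exact ⟨ha', hb'⟩
  · exact ⟨hb', ha'⟩

lemma eq_of_subset_of_cover {X Y : Finset (Finset Plane)} (hS : IsTiling P S) (hY : Y ⊆ S)
    (hXY : X ⊆ Y)
    (hcov : ∀ x, Generic P x → (∃ t ∈ Y, x ∈ convexHull ℝ (t : Set Plane)) →
      ∃ t ∈ X, x ∈ convexHull ℝ (t : Set Plane)) : X = Y := by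
  refine hXY.antisymm fun s hs => ?_
  obtain ⟨x, hx, hxg⟩ := exists_generic P isOpen_interior
    (hS.isTriangle s (hY hs)).nonempty_interior
  obtain ⟨t, ht, hxt⟩ := hcov x hxg ⟨s, hs, interior_subset hx⟩
  rwa [hS.unique x hxg s (hY hs) t (hY (hXY ht)) (interior_subset hx) hxt]

/-- Two optimal tilings agree within each circle: otherwise exchanging their triangles inscribed in
that circle would improve one of them. -/
lemma IsMaxTiling.eq (hP : affineSpan ℝ (P : Set Plane) = ⊤) (hD : DistinctPairwiseDistances P)
    (hT : IsMaxTiling P T) (hS : IsMaxTiling P S) : T = S := by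
  classical
  have hTd := hT.delaunay hP
  have hSd := hS.delaunay hP
  have key : ∀ H : Plane →ᵃ[ℝ] ℝ, trianglesOver T H = trianglesOver S H := fun H => by
    have c1 := fun x (hx : Generic P x) => trianglesOver_cover hT.1 hS.1 hTd hSd H hx
    have c2 := fun x (hx : Generic P x) => trianglesOver_cover hS.1 hT.1 hSd hTd H hx
    have hX : trianglesOver T H ⊆ T := Finset.filter_subset _ _
    have hY : trianglesOver S H ⊆ S := Finset.filter_subset _ _
    by_cases h1 : tilingAngles (trianglesOver T H) ≤ tilingAngles (trianglesOver S H)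
    · exact eq_of_subset_of_cover hS.1 hY (trianglesOver_subset hD hT.1 hS.1 H h1) c2
    by_cases h2 : tilingAngles (trianglesOver S H) ≤ tilingAngles (trianglesOver T H)
    · exact (eq_of_subset_of_cover hT.1 hX (trianglesOver_subset hD hS.1 hT.1 H h2) c1).symm
    exfalso
    have exch : ∀ {A B X Y : Finset (Finset Plane)}, IsMaxTiling P A → IsTiling P B → X ⊆ A →
        Y ⊆ B → (∀ x, Generic P x → ((∃ t ∈ X, x ∈ convexHull ℝ (t : Set Plane)) ↔
          ∃ t ∈ Y, x ∈ convexHull ℝ (t : Set Plane))) →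
        ¬ ∀ R : Multiset ℝ,
          (tilingAngles X + R).sort (· ≤ ·) < (tilingAngles Y + R).sort (· ≤ ·) :=
      fun hA hB hXA hYB hXY => hA.not_lt_replace hXA
        (hA.1.replace hXA (fun t ht => hB.subset t (hYB ht)) (fun t ht => hB.isTriangle t (hYB ht))
          (fun t ht => hB.empty t (hYB ht))
          (fun x hx s hs t ht => hB.unique x hx s (hYB hs) t (hYB ht)) hXY)
        (hA.1.disjoint_of_cover hXA (fun t ht => hB.isTriangle t (hYB ht)) hXY)
    rcases sort_add_lt_or h1 h2 with h | h
    · exact exch hT hS.1 hX hY (fun x hx => ⟨c1 x hx, c2 x hx⟩) h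
    · exact exch hS hT.1 hY hX (fun x hx => ⟨c2 x hx, c1 x hx⟩) h
  ext t
  have h := congrArg (t ∈ ·) (key (lift sq t))
  simpa [trianglesOver] using h

lemma exists_isMaxTiling (hP : affineSpan ℝ (P : Set Plane) = ⊤) : ∃ T, IsMaxTiling P T := by
  classical
  obtain ⟨T₀, hT₀⟩ := exists_isTiling hP
  have hmem : ∀ T, T ∈ P.powerset.powerset.filter (IsTiling P) ↔ IsTiling P T := fun T => by
    simp only [Finset.mem_filter, Finset.mem_powerset, and_iff_right_iff_imp]
    exact fun hT t ht => Finset.mem_powerset.2 (hT.subset t ht)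
  obtain ⟨T, hT, hmax⟩ := Finset.exists_max_image (P.powerset.powerset.filter (IsTiling P))
    (fun T => (tilingAngles T).sort (· ≤ ·)) ⟨T₀, (hmem T₀).2 hT₀⟩
  exact ⟨T, (hmem T).1 hT, fun S hS => hmax S ((hmem S).2 hS)⟩

/-! ### Triangulations and tilings -/

variable {τ : Geometry.SimplicialComplex ℝ Plane}

lemma IsTriangulation.subset (h : IsTriangulation P τ) {f : Finset Plane} (hf : f ∈ τ.faces) :
    f ⊆ P := fun v hv => by
  have h1 : v ∈ τ.vertices :=
    τ.down_closed hf (Finset.singleton_subset_iff.2 hv) (Finset.singleton_nonempty v)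
  rw [h.vertices_eq] at h1
  exact h1

lemma IsTriangulation.singleton_mem (h : IsTriangulation P τ) {p : Plane} (hp : p ∈ P) :
    {p} ∈ τ.faces := by
  have : p ∈ τ.vertices := by rw [h.vertices_eq]; exact hp
  exact this

lemma IsTriangulation.empty (h : IsTriangulation P τ) {f : Finset Plane} (hf : f ∈ τ.faces)
    {p : Plane} (hp : p ∈ P) (hpf : p ∈ convexHull ℝ (f : Set Plane)) : p ∈ f := by
  have h1 := τ.inter_subset_convexHull (h.singleton_mem hp) hf ⟨by simp, hpf⟩
  obtain ⟨q, hq1, hq2⟩ := convexHull_nonempty_iff.1 ⟨p, h1⟩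
  rw [Finset.coe_singleton, Set.mem_singleton_iff] at hq1
  exact hq1 ▸ hq2

lemma mem_triangles : t ∈ triangles P τ ↔ t ⊆ P ∧ t.card = 3 ∧ t ∈ τ.faces := by
  simp [triangles, Finset.mem_powersetCard, and_assoc]

/-- The midpoint of an edge is in no proper face of it. -/
lemma pair_subset_of_midpoint_mem {a b : Plane} (hab : a ≠ b) {s : Set Plane}
    (h : midpoint ℝ a b ∈ convexHull ℝ ({a, b} ∩ s)) : {a, b} ⊆ s := by
  rintro v hv
  by_contra hn
  rcases hv with rfl | hv
  · have := convexHull_mono (t := {b}) (by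
      rintro u ⟨rfl | hu, hus⟩
      · exact absurd hus hn
      · exact hu) h
    rw [convexHull_singleton, Set.mem_singleton_iff, midpoint_eq_right_iff] at this
    exact hab this
  · rw [Set.mem_singleton_iff] at hv
    subst hv
    have := convexHull_mono (t := {a}) (by
      rintro u ⟨hu | hu, hus⟩
      · exact hu
      · rw [Set.mem_singleton_iff] at hu
        exact absurd (hu ▸ hus) hn) h
    rw [convexHull_singleton, Set.mem_singleton_iff, midpoint_eq_left_iff] at this
    exact hab this

lemma midpoint_mem_convexHull {a b : Plane} {s : Set Plane} (ha : a ∈ s) (hb : b ∈ s) :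
    midpoint ℝ a b ∈ convexHull ℝ s :=
  segment_subset_convexHull ha hb (midpoint_mem_segment a b)

lemma two_le_card_of_span (hP : affineSpan ℝ (P : Set Plane) = ⊤) : 2 ≤ P.card := by
  obtain ⟨T, hT⟩ := exists_isTiling hP
  obtain ⟨x, hx, hxg⟩ := exists_generic P isOpen_interior
    (interior_convexHull_nonempty_iff_affineSpan_eq_top.2 hP)
  obtain ⟨t, ht, -⟩ := hT.cover x hxg (interior_subset hx)
  exact (hT.isTriangle t ht).two_le_card (hT.subset t ht)

lemma IsTriangulation.isTiling (hP : affineSpan ℝ (P : Set Plane) = ⊤) (h : IsTriangulation P τ) :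
    IsTiling P (triangles P τ) where
  subset t ht := (mem_triangles.1 ht).1
  isTriangle t ht := ⟨(mem_triangles.1 ht).2.1, τ.indep (mem_triangles.1 ht).2.2⟩
  empty t ht p hp hpt := h.empty (mem_triangles.1 ht).2.2 hp hpt
  cover x hx hxP := by
    rw [← h.space_eq, Geometry.SimplicialComplex.mem_space_iff] at hxP
    obtain ⟨f, hf, hxf⟩ := hxP
    have h1 := affineIndependent_card_le (τ.indep hf)
    refine ⟨f, mem_triangles.2 ⟨h.subset hf, ?_, hf⟩, hxf⟩
    by_contra h2
    exact hx.notMem_convexHull (two_le_card_of_span hP) (h.subset hf) (by omega) hxf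
  unique x hx s hs t ht hxs hxt := by
    classical
    obtain ⟨hs1, hs2, hs3⟩ := mem_triangles.1 hs
    obtain ⟨ht1, ht2, ht3⟩ := mem_triangles.1 ht
    have h1 := τ.inter_subset_convexHull hs3 ht3 ⟨hxs, hxt⟩
    rw [← Finset.coe_inter] at h1
    have h2 : 2 < (s ∩ t).card := by
      by_contra! h2
      exact hx.notMem_convexHull (two_le_card_of_span hP) (Finset.inter_subset_left.trans hs1) h2 h1
    have h3 : s ∩ t = s := Finset.eq_of_subset_of_card_le Finset.inter_subset_left (by omega)
    exact Finset.eq_of_subset_of_card_le (Finset.inter_eq_left.1 h3) (by omega)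

/-- A triangulation of a noncollinear set is determined by its triangles. -/
lemma IsTriangulation.mem_faces_iff (hP : affineSpan ℝ (P : Set Plane) = ⊤)
    (h : IsTriangulation P τ) {f : Finset Plane} :
    f ∈ τ.faces ↔ f.Nonempty ∧ ∃ t ∈ triangles P τ, f ⊆ t := by
  classical
  have hT := h.isTiling hP
  constructor
  · intro hf
    have hne := Geometry.SimplicialComplex.nonempty_of_mem_faces hf
    refine ⟨hne, ?_⟩
    have h1 := affineIndependent_card_le (τ.indep hf)
    have h2 := hne.card_pos
    obtain h3 | h3 | h3 : f.card = 1 ∨ f.card = 2 ∨ f.card = 3 := by omega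
    · obtain ⟨p, rfl⟩ := Finset.card_eq_one.1 h3
      have hp : p ∈ P := h.subset hf (by simp)
      obtain ⟨t, ht, hpt⟩ := hT.exists_mem hP (subset_convexHull ℝ _ hp)
      exact ⟨t, ht, by simpa using hT.empty t ht p hp hpt⟩
    · obtain ⟨a, b, hab, rfl⟩ := Finset.card_eq_two.1 h3
      obtain ⟨t, ht, hmt⟩ := hT.exists_mem hP (midpoint_mem_convexHull
        (h.subset hf (by simp : a ∈ _)) (h.subset hf (by simp : b ∈ _)))
      have h4 := τ.inter_subset_convexHull hf (mem_triangles.1 ht).2.2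
        ⟨midpoint_mem_convexHull (by simp : a ∈ _) (by simp : b ∈ _), hmt⟩
      refine ⟨t, ht, ?_⟩
      rw [Finset.coe_pair] at h4
      rw [← Finset.coe_subset, Finset.coe_pair]
      exact pair_subset_of_midpoint_mem hab h4
    · exact ⟨f, mem_triangles.2 ⟨h.subset hf, h3, hf⟩, subset_rfl⟩
  · rintro ⟨hne, t, ht, hft⟩
    exact τ.down_closed (mem_triangles.1 ht).2.2 hft hne

lemma IsTriangle.mem_convexHull_inter (ht : IsTriangle t) {f g : Set Plane} (hf : f ⊆ t)
    (hg : g ⊆ t) {x : Plane} (hxf : x ∈ convexHull ℝ f) (hxg : x ∈ convexHull ℝ g) :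
    x ∈ convexHull ℝ (f ∩ g) := by
  classical
  lift f to Finset Plane using t.finite_toSet.subset hf
  lift g to Finset Plane using t.finite_toSet.subset hg
  rw [← Finset.coe_inter]
  rw [Finset.coe_subset] at hf hg
  refine ht.mem_convexHull_sub (Finset.inter_subset_left.trans hf)
    (fun v hv => ht.bary_nonneg (convexHull_mono (Finset.coe_subset.2 hf) hxf) hv)
    fun v hv hvn => ?_
  rw [Finset.mem_inter, not_and_or] at hvn
  rcases hvn with h | h
  · exact ht.bary_eq_zero hf hxf hv h
  · exact ht.bary_eq_zero hg hxg hv h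

/-- The simplicial complex generated by the triangles of a tiling. -/
def IsTiling.complex (hT : IsTiling P T) : Geometry.SimplicialComplex ℝ Plane where
  faces := {f | f.Nonempty ∧ ∃ t ∈ T, f ⊆ t}
  isRelLowerSet_faces := by
    rintro f ⟨hf, t, ht, hft⟩
    exact ⟨hf, fun g hg hne => ⟨hne, t, ht, hg.trans hft⟩⟩
  indep := by
    rintro f ⟨-, t, ht, hft⟩
    exact (hT.isTriangle t ht).2.mono (Finset.coe_subset.2 hft)
  inter_subset_convexHull := by
    rintro f g ⟨-, t, ht, hft⟩ ⟨-, s, hs, hgs⟩ x ⟨hxf, hxg⟩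
    rw [← Finset.coe_subset] at hft hgs
    have h1 := hT.glue ht hs (convexHull_mono hft hxf) (convexHull_mono hgs hxg)
    have h2 := (hT.isTriangle t ht).mem_convexHull_inter hft Set.inter_subset_left hxf h1
    have h3 := (hT.isTriangle s hs).mem_convexHull_inter
      (Set.inter_subset_right.trans Set.inter_subset_right) hgs h2 hxg
    exact convexHull_mono (Set.inter_subset_inter_left _ Set.inter_subset_left) h3

lemma IsTiling.mem_complex (hT : IsTiling P T) {f : Finset Plane} :
    f ∈ hT.complex.faces ↔ f.Nonempty ∧ ∃ t ∈ T, f ⊆ t := Iff.rfl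

lemma IsTiling.isTriangulation (hP : affineSpan ℝ (P : Set Plane) = ⊤) (hT : IsTiling P T) :
    IsTriangulation P hT.complex where
  vertices_eq := by
    ext p
    rw [Geometry.SimplicialComplex.mem_vertices, hT.mem_complex]
    simp only [Finset.singleton_nonempty, Finset.singleton_subset_iff, true_and, Finset.mem_coe]
    constructor
    · rintro ⟨t, ht, hpt⟩
      exact hT.subset t ht hpt
    · intro hp
      obtain ⟨t, ht, hpt⟩ := hT.exists_mem hP (subset_convexHull ℝ _ hp)
      exact ⟨t, ht, hT.empty t ht p hp hpt⟩
  space_eq := by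
    ext x
    rw [Geometry.SimplicialComplex.mem_space_iff]
    constructor
    · rintro ⟨f, ⟨-, t, ht, hft⟩, hxf⟩
      exact convexHull_mono (Finset.coe_subset.2 (hft.trans (hT.subset t ht))) hxf
    · intro hx
      obtain ⟨t, ht, hxt⟩ := hT.exists_mem hP hx
      exact ⟨t, ⟨Finset.coe_nonempty.1 (convexHull_nonempty_iff.1 ⟨x, hxt⟩), t, ht, subset_rfl⟩,
        hxt⟩

lemma IsTiling.triangles_complex (hT : IsTiling P T) : triangles P hT.complex = T := by
  ext t
  rw [mem_triangles, hT.mem_complex]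
  constructor
  · rintro ⟨-, h3, -, s, hs, hts⟩
    rwa [Finset.eq_of_subset_of_card_le hts (by rw [(hT.isTriangle s hs).1, h3])]
  · intro ht
    have h3 := (hT.isTriangle t ht).1
    exact ⟨hT.subset t ht, h3, Finset.card_pos.1 (by omega), t, ht, subset_rfl⟩

lemma existsUnique_of_span (hP : affineSpan ℝ (P : Set Plane) = ⊤)
    (hD : DistinctPairwiseDistances P) :
    ∃! τ : Geometry.SimplicialComplex ℝ Plane, IsMaxMinAngleDelaunay P τ := by
  obtain ⟨T, hT⟩ := exists_isMaxTiling hP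
  have hmax : ∀ τ, IsMaxMinAngleDelaunay P τ → IsMaxTiling P (triangles P τ) := fun τ hτ => by
    refine ⟨hτ.1.isTiling hP, fun S hS => ?_⟩
    have := hτ.2 _ (hS.isTriangulation hP)
    rw [angleList, hS.triangles_complex] at this
    exact this
  refine ⟨hT.1.complex, ⟨hT.1.isTriangulation hP, fun σ hσ => ?_⟩, fun σ hσ => ?_⟩
  · have := hT.2 _ (hσ.isTiling hP)
    rw [angleList, angleList, hT.1.triangles_complex]
    exact this
  · have h1 : triangles P σ = T := (hmax σ hσ).eq hP hD hT
    refine Geometry.SimplicialComplex.ext ?_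
    ext f
    rw [hσ.1.mem_faces_iff hP, hT.1.mem_complex, h1]

/-! ### Collinear point sets -/

/-- The faces of the only triangulation of a collinear set `P`: its points, and the segments joining
consecutive points. -/
def pathFaces (P : Finset Plane) : Set (Finset Plane) :=
  {f | f.Nonempty ∧ f ⊆ P ∧ f.card ≤ 2 ∧ ∀ p ∈ P, p ∈ convexHull ℝ (f : Set Plane) → p ∈ f}

lemma glue_pathFaces (hP : Collinear ℝ (P : Set Plane)) {f g : Finset Plane} (hf : f ∈ pathFaces P)
    (hg : g ∈ pathFaces P) {x : Plane} (hxf : x ∈ convexHull ℝ (f : Set Plane))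
    (hxg : x ∈ convexHull ℝ (g : Set Plane)) : x ∈ convexHull ℝ ((f : Set Plane) ∩ g) :=
  glue_of_collinear (hP.subset (Set.union_subset (Finset.coe_subset.2 hf.2.1)
    (Finset.coe_subset.2 hg.2.1))) hf.2.2.1 hg.2.2.1 (fun p hp => hf.2.2.2 p (hg.2.1 hp))
    (fun p hp => hg.2.2.2 p (hf.2.1 hp)) hxf hxg

lemma card_le_two_of_collinear {f : Finset Plane} (hf : AffineIndependent ℝ ((↑) : f → Plane))
    (hc : Collinear ℝ (f : Set Plane)) : f.card ≤ 2 := by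
  have h1 := hf.card_le_finrank_succ
  rw [Fintype.card_coe, Subtype.range_coe_subtype] at h1
  have h2 := collinear_iff_finrank_le_one.1 hc
  exact h1.trans (Nat.succ_le_succ h2)

/-- The triangulation of a collinear set into the segments between consecutive points. -/
def pathComplex (hP : Collinear ℝ (P : Set Plane)) : Geometry.SimplicialComplex ℝ Plane where
  faces := pathFaces P
  isRelLowerSet_faces := by
    intro f hf
    refine ⟨hf.1, fun g hg hne => ⟨hne, hg.trans hf.2.1,
      (Finset.card_le_card hg).trans hf.2.2.1, fun p hp hpg => ?_⟩⟩
    rcases eq_or_ne g f with rfl | hgf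
    · exact hf.2.2.2 p hp hpg
    · have h1 := Finset.card_lt_card (Finset.ssubset_iff_subset_ne.2 ⟨hg, hgf⟩)
      have h2 := hne.card_pos
      obtain ⟨a, rfl⟩ := Finset.card_eq_one.1 (by have := hf.2.2.1; omega : g.card = 1)
      simpa using hpg
  indep := by
    classical
    intro f hf
    have h1 := hf.1.card_pos
    have h2 := hf.2.2.1
    obtain h | h : f.card = 1 ∨ f.card = 2 := by omega
    · obtain ⟨a, rfl⟩ := Finset.card_eq_one.1 h
      exact affineIndependent_of_subsingleton ℝ _
    · obtain ⟨a, b, hab, rfl⟩ := Finset.card_eq_two.1 h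
      have h3 := (affineIndependent_of_ne ℝ hab).range
      have h4 : Set.range ![a, b] = (({a, b} : Finset Plane) : Set Plane) := by
        simp [Set.pair_comm]
      rw [h4] at h3
      exact h3
  inter_subset_convexHull := fun hf hg _ hx => glue_pathFaces hP hf hg hx.1 hx.2

/-- Each point of the hull of a collinear set lies on a point or a segment between consecutive
points, namely on the shortest segment with endpoints in `P` that contains it. -/
lemma exists_mem_pathFaces (hP : Collinear ℝ (P : Set Plane)) {x : Plane}
    (hx : x ∈ convexHull ℝ (P : Set Plane)) :
    ∃ f ∈ pathFaces P, x ∈ convexHull ℝ (f : Set Plane) := by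
  classical
  obtain ⟨a₀, ha₀, b₀, hb₀, hx₀⟩ : ∃ a ∈ P, ∃ b ∈ P, x ∈ convexHull ℝ ({a, b} : Set Plane) := by
    rw [convexHull_eq_union] at hx
    simp only [Set.mem_iUnion] at hx
    obtain ⟨f, hfP, hind, hxf⟩ := hx
    obtain ⟨a, b, he⟩ := exists_eq_pair_of_card_le_two
      (Finset.coe_nonempty.1 (convexHull_nonempty_iff.1 ⟨x, hxf⟩))
      (card_le_two_of_collinear hind (hP.subset hfP))
    rw [he] at hfP hxf
    exact ⟨a, hfP (by simp), b, hfP (by simp), hxf⟩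
  obtain ⟨⟨a, b⟩, hab, hmin⟩ := Finset.exists_min_image
    ((P ×ˢ P).filter fun e => x ∈ convexHull ℝ ({e.1, e.2} : Set Plane))
    (fun e => dist e.1 e.2) ⟨(a₀, b₀), Finset.mem_filter.2 ⟨Finset.mem_product.2 ⟨ha₀, hb₀⟩, hx₀⟩⟩
  simp only [Finset.mem_filter, Finset.mem_product, Prod.forall] at hab hmin
  obtain ⟨⟨ha, hb⟩, hxab⟩ := hab
  refine ⟨{a, b}, ⟨by simp, by simp [Finset.insert_subset_iff, ha, hb], Finset.card_le_two,
    fun p hp hpab => ?_⟩, by simpa using hxab⟩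
  rw [Finset.coe_pair] at hpab
  by_contra hn
  simp only [Finset.mem_insert, Finset.mem_singleton, not_or] at hn
  have hd := dist_add_dist_of_mem_segment (by rwa [convexHull_pair] at hpab : p ∈ segment ℝ a b)
  have h1 : 0 < dist a p := dist_pos.2 (Ne.symm hn.1)
  have h2 : 0 < dist p b := dist_pos.2 hn.2
  set φ : ℝ →ᵃ[ℝ] Plane := AffineMap.lineMap a b with hφ
  have e0 : φ 0 = a := by simp [hφ]
  have e1 : φ 1 = b := by simp [hφ]
  rw [← e0, ← e1, mem_convexHull_pair_lineMap zero_le_one] at hxab hpab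
  obtain ⟨r, hr0, hr1, rfl⟩ := hxab
  obtain ⟨s, hs0, hs1, rfl⟩ := hpab
  rcases le_total r s with h | h
  · have := hmin a (φ s) ⟨⟨ha, hp⟩, by
      rw [← e0, mem_convexHull_pair_lineMap hs0]; exact ⟨r, hr0, h, rfl⟩⟩
    linarith
  · have := hmin (φ s) b ⟨⟨hp, hb⟩, by
      rw [← e1, mem_convexHull_pair_lineMap hs1]; exact ⟨r, h, hr1, rfl⟩⟩
    linarith

lemma isTriangulation_pathComplex (hP : Collinear ℝ (P : Set Plane)) :
    IsTriangulation P (pathComplex hP) where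
  vertices_eq := by
    ext p
    constructor
    · intro hp
      exact hp.2.1 (by simp)
    · intro hp
      exact ⟨by simp, by simpa using hp, by simp, by simp⟩
  space_eq := by
    ext x
    rw [Geometry.SimplicialComplex.mem_space_iff]
    constructor
    · rintro ⟨f, hf, hxf⟩
      exact convexHull_mono (Finset.coe_subset.2 hf.2.1) hxf
    · exact exists_mem_pathFaces hP

lemma IsTriangulation.eq_pathComplex (hP : Collinear ℝ (P : Set Plane)) (h : IsTriangulation P τ) :
    τ = pathComplex hP := by
  classical
  have hsub : ∀ f ∈ τ.faces, f ∈ pathFaces P := fun f hf =>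
    ⟨Geometry.SimplicialComplex.nonempty_of_mem_faces hf, h.subset hf,
      card_le_two_of_collinear (τ.indep hf) (hP.subset (Finset.coe_subset.2 (h.subset hf))),
      fun p hp hpf => h.empty hf hp hpf⟩
  refine Geometry.SimplicialComplex.ext (Set.Subset.antisymm hsub fun f hf => ?_)
  change f ∈ pathFaces P at hf
  have h1 := hf.1.card_pos
  have h2 := hf.2.2.1
  obtain h3 | h3 : f.card = 1 ∨ f.card = 2 := by omega
  · obtain ⟨a, rfl⟩ := Finset.card_eq_one.1 h3
    exact h.singleton_mem (hf.2.1 (by simp))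
  · obtain ⟨a, b, hab, rfl⟩ := Finset.card_eq_two.1 h3
    have hm : midpoint ℝ a b ∈ τ.space := by
      rw [h.space_eq]
      exact midpoint_mem_convexHull (hf.2.1 (by simp)) (hf.2.1 (by simp))
    obtain ⟨g, hg, hmg⟩ := Geometry.SimplicialComplex.mem_space_iff.1 hm
    have h4 := glue_pathFaces hP hf (hsub g hg)
      (midpoint_mem_convexHull (by simp : a ∈ _) (by simp : b ∈ _)) hmg
    rw [Finset.coe_pair] at h4
    refine τ.down_closed hg ?_ hf.1
    rw [← Finset.coe_subset, Finset.coe_pair]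
    exact pair_subset_of_midpoint_mem hab h4

lemma collinear_of_span_ne_top (hP : affineSpan ℝ (P : Set Plane) ≠ ⊤) :
    Collinear ℝ (P : Set Plane) := by
  rcases (P : Set Plane).eq_empty_or_nonempty with h | h
  · rw [h]; exact collinear_empty ℝ _
  · rw [collinear_iff_finrank_le_one]
    have h1 : vectorSpan ℝ (P : Set Plane) ≠ ⊤ := fun h2 =>
      hP ((AffineSubspace.affineSpan_eq_top_iff_vectorSpan_eq_top_of_nonempty ℝ _ _ h).2 h2)
    have h2 := Submodule.finrank_lt h1
    have h3 : Module.finrank ℝ Plane = 2 := by simp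
    omega

end MaxMinAngle

end

theorem mainTheorem3 (P : Finset MaxMinAngle.Plane)
    (hP : MaxMinAngle.DistinctPairwiseDistances P) :
    ∃! τ : Geometry.SimplicialComplex ℝ MaxMinAngle.Plane,
      MaxMinAngle.IsMaxMinAngleDelaunay P τ := by
  by_cases h : affineSpan ℝ (P : Set MaxMinAngle.Plane) = ⊤
  · exact MaxMinAngle.existsUnique_of_span h hP
  · have hc := MaxMinAngle.collinear_of_span_ne_top h
    refine ⟨MaxMinAngle.pathComplex hc, ⟨MaxMinAngle.isTriangulation_pathComplex hc,
      fun σ hσ => ?_⟩, fun σ hσ => hσ.1.eq_pathComplex hc⟩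
    rw [hσ.eq_pathComplex hc]
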